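/- Let $\mathbb{Q}_{\mathbb{C}}$ be the algebra of complexified quaternions, with conjugation $(s+x\mathbf{i}+y\mathbf{j}+z\mathbf{k})^{*}=s-x\mathbf{i}-y\mathbf{j}-z\mathbf{k}$ ($s,x,y,z\in\mathbb{C}$). For an $m\times m$ matrix $X$ over $\mathbb{Q}_{\mathbb{C}}$ let $$\mathrm{Det}_M(X)=\sum_{\sigma\in S_m}\mathrm{sgn}(\sigma)\,(X_{n_1i_2}X_{i_2i_3}\cdots X_{i_sn_1})\cdots(X_{n_rk_2}X_{k_2k_3}\cdots X_{k_ln_r})$$ be its Moore--Dyson determinant, where $\sigma=(n_1i_2\ldots i_s)\cdots(n_rk_2\ldots k_l)$ is written as a product of cycles, each beginning with its largest element, and $n_1>\dots>n_r$. Let $(\Lambda,\mu)$ be a $\sigma$-finite measure space. A random point field on $\Lambda$ is a probability measure on the space of countable configurations of points of $\Lambda$. A measurable function $R_k\colon\Lambda^k\to[0,\infty)$ is a $k$-point correlation function of it if, for all disjoint measurable $A_1,\dots,A_m\subseteq\Lambda$ and all integers $k_i\ge 0$ with $k_1+\dots+k_m=k$, $$\mathbb{E}\prod_{i=1}^m \#(A_i)(\#(A_i)-1)\cdots(\#(A_i)-k_i+1)=\int_{A_1^{k_1}\times\cdots\times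 A_m^{k_m}}R_k\,d\mu^{k},$$ where $\#(A)$ is the number of points in $A$. The field is Pfaffian with kernel $K\colon\Lambda\times\Lambda\to\mathbb{Q}_{\mathbb{C}}$ if $K(y,x)=K(x,y)^{*}$ for all $x,y$ and if, for every $m\ge1$, it has an $m$-point correlation function equal to $\mathrm{Det}_M\big(K(x_i,x_j)\big)_{1\le i,j\le m}$ almost everywhere. The kernel has finite rank if $K(x,y)=\sum_{k=1}^{r}f_k(x)g_k(y)^{*}$ for some finite $r$ and measurable $f_k,g_k\colon\Lambda\to\mathbb{Q}_{\mathbb{C}}$ such that all $g_j^{*}f_k$ are $\mu$-integrable. A number $\lambda\in\mathbb{C}$ is an eigenvalue of $K$ if there is a measurable $v\colon\Lambda\to\mathbb{Q}_{\mathbb{C}}$, not almost everywhere zero, such that $\int_\Lambda K(x,y)v(y)\,d\mu(y)=v(x)\lambda$ for almost every $x$ (the integrand being integrable). **Theorem.** For $n\in\mathbb{N}$ let $\mathcal{X}_n$ be a Pfaffian random point field on a $\sigma$-finite measure space $(\Lambda_n,\mu_n)$ with a finite-rank kernel $K_n$, and let $\mathcal{N}_n$ denote its number of points. Suppose that all eigenvalues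 of the kernels $K_n$ are real and lie in $[0,1]$, and that $\mathrm{Var}(\mathcal{N}_n)\to\infty$ as $n\to\infty$. Then every $\mathcal{N}_n$ is almost surely finite and square integrable, and the random variables $(\mathcal{N}_n-\mathbb{E}\,\mathcal{N}_n)/\sqrt{\mathrm{Var}(\mathcal{N}_n)}$ converge in distribution to a standard Gaussian random variable as $n\to\infty$. -/

import Mathlib

open MeasureTheory ProbabilityTheory Filter Topology
open scoped ENNReal NNReal Quaternion

noncomputable section

namespace PfaffianField

/-! ### Random point fields -/

/-- A countable configuration of points of `Λ`, given by the (finite) multiplicity of each point. -/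
structure Configuration (Λ : Type*) where
  /-- number of times that a point occurs in the configuration -/
  mult : Λ → ℕ
  countable_support : (Function.support mult).Countable

/-- The number of points of a configuration that lie in `A`, with values in `[0, ∞]`. -/
def Configuration.count {Λ : Type*} (c : Configuration Λ) (A : Set Λ) : ℝ≥0∞ :=
  ∑' x : A, (c.mult x : ℝ≥0∞)

/-- The σ-algebra on configurations generated by the counts of points in measurable sets.
A random point field on `Λ` is a probability measure on this measurable space. -/
instance Configuration.instMeasurableSpace {Λ : Type*} [MeasurableSpace Λ] :
    MeasurableSpace (Configuration Λ) :=
  ⨆ (A : Set Λ) (_ : MeasurableSet A),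
    MeasurableSpace.comap (fun c : Configuration Λ => c.count A) inferInstance

/-- The total number of points of a configuration, as a real number
(meaningful when that number is finite). -/
def numPoints {Λ : Type*} (c : Configuration Λ) : ℝ :=
  (c.count Set.univ).toReal

/-- `R` is a `k`-point correlation function, with respect to `μ`, of the random point field `P`:
for disjoint measurable sets `A₁, …, A_m` and `k₁ + ⋯ + k_m = k`,
`𝔼 ∏ᵢ #(Aᵢ) (#(Aᵢ) - 1) ⋯ (#(Aᵢ) - kᵢ + 1)` is the integral of `R` over
`A₁^{k₁} × ⋯ × A_m^{k_m}`. Both sides are taken in `[0, ∞]`; the truncated subtraction does no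
harm there, because the product has a vanishing factor as soon as `#(Aᵢ) < kᵢ`. -/
def IsCorrelationFunction {Λ : Type*} [MeasurableSpace Λ] (P : Measure (Configuration Λ))
    (μ : Measure Λ) (k : ℕ) (R : (Fin k → Λ) → ℝ≥0) : Prop :=
  Measurable R ∧
  ∀ (m : ℕ) (A : Fin m → Set Λ) (κ : Fin m → ℕ) (hκ : ∑ i, κ i = k),
    (∀ i, MeasurableSet (A i)) → (∀ i j, i ≠ j → Disjoint (A i) (A j)) →
    ∫⁻ c, ∏ i, ∏ j ∈ Finset.range (κ i), (c.count (A i) - (j : ℝ≥0∞)) ∂P =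
      ∫⁻ x in {x : Fin k → Λ | ∀ (i : Fin m) (j : Fin (κ i)),
          x (Fin.cast hκ (finSigmaFinEquiv ⟨i, j⟩)) ∈ A i},
        (R x : ℝ≥0∞) ∂(Measure.pi fun _ => μ)

/-! ### The Moore-Dyson determinant -/

/-- The ordered product `X_{a b} X_{b c} ⋯ X_{z a}` along the cycle `(a b c … z)` of `σ` that
starts at `a`, i.e. `b = σ a`, `c = σ (σ a)`, … -/
def cycleProd {Q : Type*} [Ring Q] {n : ℕ} (X : Matrix (Fin n) (Fin n) Q)
    (σ : Equiv.Perm (Fin n)) (a : Fin n) : Q :=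
  ((List.range (Function.minimalPeriod σ a)).map
    fun s => X ((σ ^ s) a) ((σ ^ (s + 1)) a)).prod

/-- The largest elements of the cycles of `σ` (fixed points included), in decreasing order. -/
def cycleLeaders {n : ℕ} (σ : Equiv.Perm (Fin n)) : List (Fin n) :=
  (List.finRange n).reverse.filter fun a => decide (∀ b, σ.SameCycle a b → b ≤ a)

/-- The Moore-Dyson determinant: every permutation is written as a product of cycles, each of
them beginning with its largest element, in decreasing order of these largest elements. -/
def mooreDet {Q : Type*} [Ring Q] {n : ℕ} (X : Matrix (Fin n) (Fin n) Q) : Q :=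
  ∑ σ : Equiv.Perm (Fin n),
    ((Equiv.Perm.sign σ : ℤ) : Q) * ((cycleLeaders σ).map (cycleProd X σ)).prod

/-! ### Functions with values in the complexified quaternions `ℍ[ℂ]`

In `ℍ[ℂ]` the operation `star` is the quaternion conjugation
`s + x i + y j + z k ↦ s - x i - y j - z k`, with no conjugation of the complex coefficients. -/

variable {Λ : Type*} [MeasurableSpace Λ]

/-- Coordinatewise measurability. -/
def QMeasurable (u : Λ → ℍ[ℂ]) : Prop :=
  Measurable (fun x => (u x).re) ∧ Measurable (fun x => (u x).imI) ∧
  Measurable (fun x => (u x).imJ) ∧ Measurable (fun x => (u x).imK)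

/-- Coordinatewise integrability. -/
def QIntegrable (u : Λ → ℍ[ℂ]) (μ : Measure Λ) : Prop :=
  Integrable (fun x => (u x).re) μ ∧ Integrable (fun x => (u x).imI) μ ∧
  Integrable (fun x => (u x).imJ) μ ∧ Integrable (fun x => (u x).imK) μ

/-- Coordinatewise integral. -/
def qIntegral (u : Λ → ℍ[ℂ]) (μ : Measure Λ) : ℍ[ℂ] :=
  ⟨∫ x, (u x).re ∂μ, ∫ x, (u x).imI ∂μ, ∫ x, (u x).imJ ∂μ, ∫ x, (u x).imK ∂μ⟩

/-! ### Kernels and Pfaffian point fields -/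

/-- The random point field `P` is Pfaffian with kernel `K`: the kernel is self-dual and, for every
`m ≥ 1`, `P` has an `m`-point correlation function which is (almost everywhere) the Moore-Dyson
determinant of the matrix `K(x_i, x_j)`. -/
def IsPfaffianField (P : Measure (Configuration Λ)) (μ : Measure Λ)
    (K : Λ → Λ → ℍ[ℂ]) : Prop :=
  (∀ x y, K y x = star (K x y)) ∧
  ∀ m : ℕ, 1 ≤ m → ∃ R : (Fin m → Λ) → ℝ≥0, IsCorrelationFunction P μ m R ∧
    ∀ᵐ x ∂(Measure.pi fun _ : Fin m => μ),
      (((R x : ℝ) : ℂ) : ℍ[ℂ]) = mooreDet (Matrix.of fun i j => K (x i) (x j))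

/-- The kernel `K` has finite rank: `K(x, y) = ∑_{k<r} f_k(x) g_k(y)^*`, where the functions
`g_j^* f_k` are integrable, so that `K` acts on the span of the `f_k` as an integral operator.
(Square integrable `f_k`, `g_k` satisfy this.) -/
def IsFiniteRank (K : Λ → Λ → ℍ[ℂ]) (μ : Measure Λ) : Prop :=
  ∃ (r : ℕ) (f g : Fin r → Λ → ℍ[ℂ]),
    (∀ k, QMeasurable (f k)) ∧ (∀ k, QMeasurable (g k)) ∧
    (∀ j k, QIntegrable (fun x => star (g j x) * f k x) μ) ∧
    ∀ x y, K x y = ∑ k, f k x * star (g k y)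

/-- The number `z` is a (right) eigenvalue of the kernel `K`: there is a quaternion function `v`,
not almost everywhere zero, with `∫ K(x, y) v(y) dμ(y) = v(x) z` for almost every `x`. -/
def IsEigenvalue (K : Λ → Λ → ℍ[ℂ]) (μ : Measure Λ) (z : ℂ) : Prop :=
  ∃ v : Λ → ℍ[ℂ], QMeasurable v ∧ ¬ (∀ᵐ x ∂μ, v x = 0) ∧
    ∀ᵐ x ∂μ, QIntegrable (fun y => K x y * v y) μ ∧
      qIntegral (fun y => K x y * v y) μ = v x * (z : ℍ[ℂ])

end PfaffianField

end

/-! The number of points has the characteristic function of a sum of independent Bernoulli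
variables, so a central limit theorem with diverging variance applies.

Reversing a cycle of a permutation preserves its sign and, for a self-dual matrix, conjugates the
product along the cycle. Averaging over reversals replaces every cycle product in the Moore-Dyson
determinant by its scalar part (`mooreDet_eq_sum_re`), which is half the trace of a product of
complex `2 × 2` matrices. For a kernel `∑ f_k g_k^*`, integrating over all points then gives the
factorial moments `ρ_m = ∑_σ sgn σ (1/2)^{c(σ)} ∏ tr M^{ℓ}`. Here `M` is the `2r × 2r` matrix of the
integrals of `g_j^* f_k`, `c(σ)` counts the cycles and `ℓ` runs over their lengths
(`integral_pointFun`).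

With an integer `k` in place of `1/2`, the same sum divided by `m!` is a coefficient of `det(1 +
zM)^k`. It is polynomial in `k`, so the convolution identity for powers extends to `1/2`
(`sum_alphaMinorSum_half`): `F(z) = ∑ ρ_m z^m / m!` satisfies `F² = det(1 + zM)`. Since all `ρ_m ≥
0` and the right side has degree at most `2r`, `F` is a polynomial of degree at most `r`, and there
are almost surely at most `r` points. A root `a` of `F` gives the eigenvalue `-1/a` of `M`, hence of
`K`, so it lies in `[0, 1]`. Thus `F = ∏ (1 + ν_j z)` with `ν_j ∈ [0, 1]`, and `𝔼 e^{itN} = F(e^{it}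
- 1)` has the Bernoulli form (`exists_bernoulli_parameters`).

Finally, the characteristic function of the normalized sum differs from `e^{-t²/2}` by at most
`2|t|³ / √Var` once `|t| ≤ √Var`. -/

noncomputable section

namespace PfaffianField

/-! ### Cycle decompositions and traces of ordered products -/

section Cycles

/-- The weight `g` on the two end labels lets the induction absorb the last matrix, and later closes
the path into a cycle. -/
theorem sum_mul_prod_range {I R : Type*} [Fintype I] [DecidableEq I] [CommRing R]
    (B : ℕ → Matrix I I R) (q : ℕ) (g : I → I → R) :
    ∑ i, ∑ j, (((List.range q).map B).prod i j) * g i j =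
      ∑ κ : Fin (q + 1) → I,
        (∏ s : Fin q, B s (κ s.castSucc) (κ s.succ)) * g (κ 0) (κ (Fin.last q)) := by
  induction q generalizing g with
  | zero =>
    rw [← (Equiv.funUnique (Fin 1) I).symm.sum_comp]
    simp [Matrix.one_apply]
  | succ q ih =>
    have h := ih (fun i k => ∑ j, B q k j * g i j)
    rw [← (Fin.snocEquiv fun _ : Fin (q + 2) => I).sum_comp, Fintype.sum_prod_type_right]
    calc _ = ∑ i, ∑ k, (((List.range q).map B).prod i k) * ∑ j, B q k j * g i j := by
          refine Finset.sum_congr rfl fun i _ => ?_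
          simp only [List.range_succ, List.map_append, List.map_cons, List.map_nil,
            List.prod_append, List.prod_singleton, Matrix.mul_apply, Finset.sum_mul,
            Finset.mul_sum]
          rw [Finset.sum_comm]
          simp only [mul_assoc]
      _ = _ := by
          rw [h]
          refine Finset.sum_congr rfl fun κ _ => ?_
          rw [Finset.mul_sum]
          refine Finset.sum_congr rfl fun j _ => ?_
          rw [Fin.prod_univ_castSucc]
          have h0 : (Fin.snoc κ j : Fin (q + 2) → I) 0 = κ 0 := by
            exact Fin.snoc_castSucc (α := fun _ => I) j κ 0
          have hs : ∀ s : Fin q, (Fin.snoc κ j : Fin (q + 2) → I) s.castSucc.succ = κ s.succ := by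
            intro s
            rw [Fin.succ_castSucc]
            exact Fin.snoc_castSucc (α := fun _ => I) j κ _
          simp [Fin.snocEquiv, h0, hs, mul_assoc]

theorem trace_prod_range_succ {I R : Type*} [Fintype I] [DecidableEq I] [CommRing R]
    (B : ℕ → Matrix I I R) (q : ℕ) :
    ((List.range (q + 1)).map B).prod.trace =
      ∑ κ : Fin (q + 1) → I, ∏ s : Fin (q + 1), B s (κ s) (κ (s + 1)) := by
  have h := sum_mul_prod_range B q (fun i j => B q j i)
  calc _ = ∑ i, ∑ j, (((List.range q).map B).prod i j) * B q j i := by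
        simp [List.range_succ, Matrix.trace, Matrix.mul_apply]
    _ = _ := by
        rw [h]
        refine Finset.sum_congr rfl fun κ _ => ?_
        rw [Fin.prod_univ_castSucc]
        simp

theorem trace_prod_range {I R : Type*} [Fintype I] [DecidableEq I] [CommRing R]
    (B : ℕ → Matrix I I R) (p : ℕ) [NeZero p] :
    ((List.range p).map B).prod.trace =
      ∑ κ : Fin p → I, ∏ s : Fin p, B s (κ s) (κ (s + 1)) := by
  obtain ⟨q, rfl⟩ := Nat.exists_eq_succ_of_ne_zero (NeZero.ne p)
  exact trace_prod_range_succ B q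

theorem mem_cycleLeaders {n : ℕ} {σ : Equiv.Perm (Fin n)} {a : Fin n} :
    a ∈ cycleLeaders σ ↔ ∀ b, σ.SameCycle a b → b ≤ a := by
  simp [cycleLeaders]

theorem nodup_cycleLeaders {n : ℕ} (σ : Equiv.Perm (Fin n)) : (cycleLeaders σ).Nodup :=
  ((List.nodup_reverse).2 (List.nodup_finRange n)).filter _

theorem minimalPeriod_pos {n : ℕ} (σ : Equiv.Perm (Fin n)) (a : Fin n) :
    0 < Function.minimalPeriod σ a :=
  Function.minimalPeriod_pos_of_mem_periodicPts
    (Function.Injective.mem_periodicPts σ.injective a)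

theorem pow_minimalPeriod_apply {n : ℕ} (σ : Equiv.Perm (Fin n)) (a : Fin n) :
    (σ ^ Function.minimalPeriod σ a) a = a := by
  rw [Equiv.Perm.coe_pow]
  exact Function.iterate_minimalPeriod

/-- Each cycle has exactly one leader, and the powers below the minimal period visit each of its
points once. -/
theorem bijective_cycle_parametrization {n : ℕ} (σ : Equiv.Perm (Fin n)) :
    Function.Bijective
      (fun p : Σ a : (cycleLeaders σ).toFinset, Fin (Function.minimalPeriod σ a) =>
        (σ ^ (p.2 : ℕ)) (p.1 : Fin n)) := by
  constructor
  · rintro ⟨⟨a, ha⟩, s⟩ ⟨⟨b, hb⟩, t⟩ h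
    simp only at h
    have ha' := mem_cycleLeaders.1 (List.mem_toFinset.1 ha)
    have hb' := mem_cycleLeaders.1 (List.mem_toFinset.1 hb)
    have hab : σ.SameCycle a b := by
      rw [← Equiv.Perm.sameCycle_pow_left (n := s), ← Equiv.Perm.sameCycle_pow_right (n := t), h]
    obtain rfl : a = b := le_antisymm (hb' _ hab.symm) (ha' _ hab)
    have : (s : ℕ) = t := by
      refine Function.iterate_injOn_Iio_minimalPeriod (f := σ) (x := a) s.2 t.2 ?_
      simpa [Equiv.Perm.coe_pow] using h
    rw [Fin.ext this]
  · intro x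
    let S := Finset.univ.filter fun y => σ.SameCycle x y
    have hS : S.Nonempty := ⟨x, by simp [S, Equiv.Perm.SameCycle.refl]⟩
    set a := S.max' hS with hadef
    have hxa : σ.SameCycle x a := (Finset.mem_filter.1 (S.max'_mem hS)).2
    have hal : a ∈ (cycleLeaders σ).toFinset := by
      rw [List.mem_toFinset, mem_cycleLeaders]
      intro b hb
      exact S.le_max' _ (by simpa [S] using hxa.trans hb)
    obtain ⟨i, hi⟩ := hxa.symm.exists_nat_pow_eq
    refine ⟨⟨⟨a, hal⟩, ⟨i % Function.minimalPeriod σ a,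
      Nat.mod_lt _ (minimalPeriod_pos σ a)⟩⟩, ?_⟩
    simp only
    rw [← hi, Equiv.Perm.coe_pow, Equiv.Perm.coe_pow, Function.iterate_mod_minimalPeriod_eq]

/-- The sum over all labellings of the product of matrix entries along a permutation is the
product of the traces of the ordered products along its cycles. -/
theorem sum_prod_eq_prod_trace {n : ℕ} {I R : Type*} [Fintype I] [DecidableEq I] [CommRing R]
    (σ : Equiv.Perm (Fin n)) (A : Fin n → Matrix I I R) :
    ∑ κ : Fin n → I, ∏ i, A i (κ i) (κ (σ i)) =
      ((cycleLeaders σ).map fun a =>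
        ((List.range (Function.minimalPeriod σ a)).map fun s => A ((σ ^ s) a)).prod.trace).prod := by
  let L := (cycleLeaders σ).toFinset
  let e := Equiv.ofBijective _ (bijective_cycle_parametrization σ)
  have hper : ∀ a : L, ∃ q, Function.minimalPeriod σ a = q + 1 := fun a =>
    ⟨_, (Nat.succ_pred_eq_of_pos (minimalPeriod_pos σ a)).symm⟩
  have hNZ : ∀ a : L, NeZero (Function.minimalPeriod σ a) := fun a =>
    ⟨(minimalPeriod_pos σ a).ne'⟩
  have hσ : ∀ (a : L) (s : Fin (Function.minimalPeriod σ a)), σ (e ⟨a, s⟩) = e ⟨a, s + 1⟩ := by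
    intro a s
    simp only [e, Equiv.ofBijective_apply]
    rw [← Equiv.Perm.mul_apply, ← pow_succ', Fin.val_add, Equiv.Perm.coe_pow, Equiv.Perm.coe_pow,
      Function.iterate_mod_minimalPeriod_eq]
    obtain ⟨q, hq⟩ := hper a
    -- A fixed point needs separate care: in `Fin 1` the element `1` has value `0`, so the two
    -- exponents differ, but every iterate of `σ` fixes `a`.
    by_cases hq0 : q = 0
    · subst hq0
      have h1 : ∀ k, (⇑σ)^[k] (a : Fin n) = a := fun k => by
        rw [← Function.iterate_mod_minimalPeriod_eq, hq]; simp [Nat.mod_one]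
      rw [h1, h1]
    · have : ((1 : Fin (Function.minimalPeriod σ a)) : ℕ) = 1 := by
        rw [Fin.val_one']
        exact Nat.mod_eq_of_lt (by omega)
      rw [this]
  have htr : ∀ a : L,
      ((List.range (Function.minimalPeriod σ a)).map fun s => A ((σ ^ s) a)).prod.trace =
      ∑ κ : Fin (Function.minimalPeriod σ a) → I,
        ∏ s, A (e ⟨a, s⟩) (κ s) (κ (s + 1)) := by
    intro a
    simp only [e, Equiv.ofBijective_apply]
    exact trace_prod_range (fun s => A ((σ ^ s) a)) _
  rw [← List.prod_toFinset _ (nodup_cycleLeaders σ), ← Finset.prod_coe_sort]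
  calc _ = ∑ κ : (Σ a : L, Fin (Function.minimalPeriod σ a)) → I,
        ∏ p, A (e p) (κ p) (κ ⟨p.1, p.2 + 1⟩) := by
        refine Fintype.sum_equiv (e.symm.arrowCongr (Equiv.refl I)) _ _ fun κ => ?_
        rw [← e.prod_comp]
        refine Finset.prod_congr rfl fun p _ => ?_
        have := hσ p.1 p.2
        simp only [Sigma.eta] at this
        simp [Equiv.arrowCongr_apply, this]
    _ = ∑ κ : (∀ a : L, Fin (Function.minimalPeriod σ a) → I),
        ∏ a : L, ∏ s, A (e ⟨a, s⟩) (κ a s) (κ a (s + 1)) := by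
        refine Fintype.sum_equiv (Equiv.piCurry fun _ _ => I) _ _ fun κ => ?_
        rw [Fintype.prod_sigma]
        rfl
    _ = _ := by
        simp only [htr]
        rw [Finset.prod_univ_sum, Fintype.piFinset_univ]

end Cycles

/-! ### Cycle reversal and scalar parts in the Moore-Dyson determinant -/

section Symmetrization

/-- The product is additive in the factor at `a`, which occurs at most once, while all other factors
agree. The doubled form avoids division by two. -/
theorem list_prod_add_list_prod {ι Q : Type*} [DecidableEq ι] [Ring Q] (a : ι) (f f' h : ι → Q)
    (l : List ι) (hl : l.Nodup) (hf : ∀ b ∈ l, b ≠ a → f b = h b)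
    (hf' : ∀ b ∈ l, b ≠ a → f' b = h b) (ha : a ∈ l → f a + f' a = h a + h a) :
    (l.map f).prod + (l.map f').prod = (l.map h).prod + (l.map h).prod := by
  induction l with
  | nil => simp
  | cons b l ih =>
    obtain ⟨hb, hl⟩ := List.nodup_cons.1 hl
    simp only [List.map_cons, List.prod_cons]
    by_cases hba : b = a
    · subst hba
      have h1 : l.map f = l.map h :=
        List.map_congr_left fun x hx =>
          hf x (List.mem_cons_of_mem _ hx) (by rintro rfl; exact hb hx)
      have h2 : l.map f' = l.map h :=
        List.map_congr_left fun x hx =>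
          hf' x (List.mem_cons_of_mem _ hx) (by rintro rfl; exact hb hx)
      rw [h1, h2, ← add_mul, ha List.mem_cons_self, add_mul]
    · rw [hf b List.mem_cons_self hba, hf' b List.mem_cons_self hba, ← mul_add,
        ih hl (fun x hx => hf x (List.mem_cons_of_mem _ hx))
          (fun x hx => hf' x (List.mem_cons_of_mem _ hx))
          (fun hx => ha (List.mem_cons_of_mem _ hx)), mul_add]

/-- The permutation obtained from `σ` by reversing the cycle of `a`. -/
def reverseCycle {n : ℕ} (a : Fin n) (σ : Equiv.Perm (Fin n)) : Equiv.Perm (Fin n) :=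
  σ * (σ.cycleOf a)⁻¹ ^ 2

variable {n : ℕ} (a : Fin n) (σ : Equiv.Perm (Fin n))

theorem sign_reverseCycle : Equiv.Perm.sign (reverseCycle a σ) = Equiv.Perm.sign σ := by
  simp [reverseCycle]

theorem reverseCycle_apply (x : Fin n) :
    reverseCycle a σ x = if σ.SameCycle a x then σ⁻¹ x else σ x := by
  have hc : ∀ y, (σ.cycleOf a)⁻¹ y = if σ.SameCycle a y then σ⁻¹ y else y := by
    intro y
    rw [Equiv.Perm.cycleOf_inv, Equiv.Perm.cycleOf_apply]
    simp only [Equiv.Perm.sameCycle_inv]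
  rw [reverseCycle, Equiv.Perm.mul_apply, pow_two, Equiv.Perm.mul_apply, hc, hc]
  by_cases h : σ.SameCycle a x
  · simp [h]
  · simp [h]

variable {a σ}

theorem reverseCycle_pow_apply_of_sameCycle {x : Fin n} (h : σ.SameCycle a x) (s : ℕ) :
    (reverseCycle a σ ^ s) x = (σ⁻¹ ^ s) x := by
  induction s with
  | zero => rfl
  | succ s ih =>
    rw [pow_succ', pow_succ', Equiv.Perm.mul_apply, Equiv.Perm.mul_apply, ih, reverseCycle_apply,
      if_pos]
    rw [inv_pow]
    simpa [← zpow_natCast, ← zpow_neg] using h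

theorem reverseCycle_pow_apply_of_not_sameCycle {x : Fin n} (h : ¬ σ.SameCycle a x) (s : ℕ) :
    (reverseCycle a σ ^ s) x = (σ ^ s) x := by
  induction s with
  | zero => rfl
  | succ s ih =>
    rw [pow_succ', pow_succ', Equiv.Perm.mul_apply, Equiv.Perm.mul_apply, ih, reverseCycle_apply,
      if_neg]
    simpa using h

variable (a σ) in
theorem sameCycle_reverseCycle (x y : Fin n) :
    (reverseCycle a σ).SameCycle x y ↔ σ.SameCycle x y := by
  by_cases hx : σ.SameCycle a x
  · constructor
    · intro h
      obtain ⟨s, hs⟩ := h.exists_nat_pow_eq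
      rw [reverseCycle_pow_apply_of_sameCycle hx] at hs
      exact Equiv.Perm.sameCycle_inv.1 ⟨s, by simpa using hs⟩
    · intro h
      obtain ⟨s, hs⟩ := (Equiv.Perm.sameCycle_inv.2 h).exists_nat_pow_eq
      rw [← reverseCycle_pow_apply_of_sameCycle hx] at hs
      exact ⟨s, by simpa using hs⟩
  · constructor
    · intro h
      obtain ⟨s, hs⟩ := h.exists_nat_pow_eq
      rw [reverseCycle_pow_apply_of_not_sameCycle hx] at hs
      exact ⟨s, by simpa using hs⟩
    · intro h
      obtain ⟨s, hs⟩ := h.exists_nat_pow_eq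
      rw [← reverseCycle_pow_apply_of_not_sameCycle hx] at hs
      exact ⟨s, by simpa using hs⟩

variable (a σ) in
theorem reverseCycle_reverseCycle : reverseCycle a (reverseCycle a σ) = σ := by
  have hinv : ∀ x, σ.SameCycle a x → (reverseCycle a σ)⁻¹ x = σ x := by
    intro x hx
    rw [Equiv.Perm.inv_eq_iff_eq, reverseCycle_apply, if_pos (by simpa using hx)]
    simp
  ext x : 1
  rw [reverseCycle_apply]
  simp only [sameCycle_reverseCycle]
  split_ifs with h
  · exact hinv x h
  · rw [reverseCycle_apply, if_neg h]

variable (a σ) in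
theorem cycleLeaders_reverseCycle : cycleLeaders (reverseCycle a σ) = cycleLeaders σ := by
  simp only [cycleLeaders, sameCycle_reverseCycle]

theorem minimalPeriod_reverseCycle (x : Fin n) :
    Function.minimalPeriod (reverseCycle a σ) x = Function.minimalPeriod σ x := by
  refine Function.minimalPeriod_eq_minimalPeriod_iff.2 fun k => ?_
  simp only [Function.IsPeriodicPt, Function.IsFixedPt, ← Equiv.Perm.coe_pow]
  by_cases hx : σ.SameCycle a x
  · rw [reverseCycle_pow_apply_of_sameCycle hx, inv_pow, Equiv.Perm.inv_eq_iff_eq, eq_comm]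
  · rw [reverseCycle_pow_apply_of_not_sameCycle hx]

variable {Q : Type*} [Ring Q] (X : Matrix (Fin n) (Fin n) Q)

theorem cycleProd_reverseCycle_of_not_sameCycle {b : Fin n} (h : ¬ σ.SameCycle a b) :
    cycleProd X (reverseCycle a σ) b = cycleProd X σ b := by
  simp only [cycleProd, minimalPeriod_reverseCycle, reverseCycle_pow_apply_of_not_sameCycle h]

/-- Conjugation reverses the order of the factors and, by self-duality, transposes the indices of
each; this is the walk along the reversed cycle from the same leader. -/
theorem cycleProd_reverseCycle_self [StarRing Q] (hX : ∀ i j, X j i = star (X i j)) :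
    cycleProd X (reverseCycle a σ) a = star (cycleProd X σ a) := by
  have key : ∀ l : List Q, star l.prod = (l.map star).reverse.prod := by
    intro l
    induction l with
    | nil => simp
    | cons x l ih => simp [ih]
  simp only [cycleProd, minimalPeriod_reverseCycle]
  rw [key, ← List.map_reverse, ← List.map_reverse, List.map_map, List.range_eq_range',
    List.reverse_range', List.map_map, ← List.range_eq_range']
  congr 1
  refine List.map_congr_left fun s hs => ?_
  set p := Function.minimalPeriod σ a with hp
  have hs : s < p := List.mem_range.1 hs
  have hrev : ∀ k ≤ p, (reverseCycle a σ ^ k) a = (σ ^ (p - k)) a := by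
    intro k hk
    rw [reverseCycle_pow_apply_of_sameCycle (Equiv.Perm.SameCycle.refl _ _), inv_pow,
      Equiv.Perm.inv_eq_iff_eq, ← Equiv.Perm.mul_apply, ← pow_add, Nat.add_sub_cancel' hk,
      pow_minimalPeriod_apply]
  rw [hrev s hs.le, hrev (s + 1) hs, Function.comp_apply, Function.comp_apply, ← hX]
  congr 3 <;> omega

theorem cycleProd_add_reverseCycle {X : Matrix (Fin n) (Fin n) ℍ[ℂ]}
    (hX : ∀ i j, X j i = star (X i j)) :
    cycleProd X σ a + cycleProd X (reverseCycle a σ) a =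
      (((cycleProd X σ a).re : ℂ) : ℍ[ℂ]) + (((cycleProd X σ a).re : ℂ) : ℍ[ℂ]) := by
  rw [cycleProd_reverseCycle_self X hX, Quaternion.self_add_star]
  rw [two_mul]

/-- In the Moore-Dyson determinant of a self-dual matrix, the products along the cycles may be
replaced by their scalar parts. -/
theorem mooreDet_eq_sum_re {X : Matrix (Fin n) (Fin n) ℍ[ℂ]} (hX : ∀ i j, X j i = star (X i j)) :
    mooreDet X = ((∑ σ : Equiv.Perm (Fin n), ((Equiv.Perm.sign σ : ℤ) : ℂ) *
      ((cycleLeaders σ).map fun a => (cycleProd X σ a).re).prod : ℂ) : ℍ[ℂ]) := by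
  -- Scalar parts are inserted for one value of the leader at a time: `h j` has replaced the cycles
  -- whose leader is below `j`.
  let h : ℕ → Equiv.Perm (Fin n) → Fin n → ℍ[ℂ] := fun j σ b =>
    if (b : ℕ) < j then (((cycleProd X σ b).re : ℂ) : ℍ[ℂ]) else cycleProd X σ b
  have step : ∀ j ≤ n, mooreDet X = ∑ σ : Equiv.Perm (Fin n),
      ((Equiv.Perm.sign σ : ℤ) : ℍ[ℂ]) * ((cycleLeaders σ).map (h j σ)).prod := by
    intro j hj
    induction j with
    | zero => simp [h, mooreDet]
    | succ j ih =>
      rw [ih (by omega)]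
      let a : Fin n := ⟨j, hj⟩
      -- This involution changes only the factor led by `a`. It preserves the sign and the list of
      -- leaders, so the order of the noncommuting factors stays the same.
      let e : Equiv.Perm (Equiv.Perm (Fin n)) :=
        Function.Involutive.toPerm
        (fun σ => if a ∈ cycleLeaders σ then reverseCycle a σ else σ) (by
          intro σ
          by_cases ha : a ∈ cycleLeaders σ
          · simp [ha, cycleLeaders_reverseCycle, reverseCycle_reverseCycle]
          · simp [ha])
      have he : ∀ σ, e σ = if a ∈ cycleLeaders σ then reverseCycle a σ else σ := fun _ => rfl
      have key : ∀ σ : Equiv.Perm (Fin n),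
          ((cycleLeaders σ).map (h j σ)).prod + ((cycleLeaders σ).map (h j (e σ))).prod =
          ((cycleLeaders σ).map (h (j + 1) σ)).prod +
            ((cycleLeaders σ).map (h (j + 1) σ)).prod := by
        intro σ
        refine list_prod_add_list_prod a _ _ _ _ (nodup_cycleLeaders σ) ?_ ?_ ?_
        · intro b _ hb
          have : (b : ℕ) ≠ j := fun hbj => hb (Fin.ext hbj)
          have : (b : ℕ) < j ↔ (b : ℕ) < j + 1 := by omega
          simp only [h, this]
        · intro b hbl hb
          have : (b : ℕ) ≠ j := fun hbj => hb (Fin.ext hbj)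
          have : (b : ℕ) < j ↔ (b : ℕ) < j + 1 := by omega
          have hcp : cycleProd X (e σ) b = cycleProd X σ b := by
            rw [he]
            split_ifs with ha
            · refine cycleProd_reverseCycle_of_not_sameCycle X fun hab => hb ?_
              exact le_antisymm (mem_cycleLeaders.1 ha _ hab) (mem_cycleLeaders.1 hbl _ hab.symm)
            · rfl
          simp only [h, this, hcp]
        · intro ha
          have : (a : ℕ) = j := rfl
          simp only [h, this, lt_irrefl, if_false, Nat.lt_succ_self, if_true]
          rw [he, if_pos ha, cycleProd_add_reverseCycle hX]
      have hsum : ∀ T : Equiv.Perm (Fin n) → ℍ[ℂ], ∑ σ, T σ + ∑ σ, T σ = ∑ σ, (T σ + T (e σ)) := by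
        intro T
        rw [Finset.sum_add_distrib, Equiv.sum_comp e T]
      have h2 : ∀ u v : ℍ[ℂ], u + u = v + v → u = v := by
        intro u v huv
        have h3 : ∀ w : ℍ[ℂ], w = (2⁻¹ : ℂ) • (w + w) := by
          intro w
          ext <;> simp <;> ring
        rw [h3 u, huv, ← h3 v]
      apply h2
      rw [hsum, ← Finset.sum_add_distrib]
      refine Finset.sum_congr rfl fun σ _ => ?_
      have : cycleLeaders (e σ) = cycleLeaders σ := by
        rw [he]; split_ifs; exacts [cycleLeaders_reverseCycle a σ, rfl]
      have hs : Equiv.Perm.sign (e σ) = Equiv.Perm.sign σ := by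
        rw [he]; split_ifs; exacts [sign_reverseCycle a σ, rfl]
      rw [this, hs, ← mul_add, ← mul_add, key]
  have hcast : ∀ z : ℂ, (z : ℍ[ℂ]) = algebraMap ℂ ℍ[ℂ] z := fun _ => rfl
  rw [step n le_rfl, hcast, map_sum]
  refine Finset.sum_congr rfl fun σ _ => ?_
  rw [map_mul, map_intCast, map_list_prod, List.map_map]
  congr 2
  refine List.map_congr_left fun b _ => ?_
  simp only [h, b.2, if_true]
  rfl

end Symmetrization

/-! ### Sums of `α`-determinants and powers of `det (1 + X M)` -/

section AlphaDeterminant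

open Matrix Kronecker Polynomial

variable {I : Type*} [Fintype I]

/-- The sum over all labellings of `Fin m` of the product of the entries of `M` along `σ`. -/
def labelSum (M : Matrix I I ℂ) {m : ℕ} (σ : Equiv.Perm (Fin m)) : ℂ :=
  ∑ κ : Fin m → I, ∏ i, M (κ i) (κ (σ i))

/-- The sum over all labellings of the `α`-determinants (with `α = t`) of the labelled minors. -/
def alphaMinorSum (M : Matrix I I ℂ) (t : ℂ) (m : ℕ) : ℂ :=
  ∑ σ : Equiv.Perm (Fin m),
    ((Equiv.Perm.sign σ : ℤ) : ℂ) * t ^ (cycleLeaders σ).length * labelSum M σ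

/-- `t ↦ alphaMinorSum M t m / m!` as a polynomial. -/
def alphaMinorPoly (M : Matrix I I ℂ) (m : ℕ) : ℂ[X] :=
  ∑ σ : Equiv.Perm (Fin m),
    C ((m.factorial : ℂ)⁻¹ * ((Equiv.Perm.sign σ : ℤ) : ℂ) * labelSum M σ) *
      X ^ (cycleLeaders σ).length

theorem eval_alphaMinorPoly (M : Matrix I I ℂ) (m : ℕ) (t : ℂ) :
    (alphaMinorPoly M m).eval t = alphaMinorSum M t m / m.factorial := by
  rw [alphaMinorPoly, eval_finsetSum, alphaMinorSum, Finset.sum_div]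
  refine Finset.sum_congr rfl fun σ _ => ?_
  simp
  ring

variable [DecidableEq I]

theorem labelSum_eq_prod_trace (M : Matrix I I ℂ) {m : ℕ} (σ : Equiv.Perm (Fin m)) :
    labelSum M σ =
      ((cycleLeaders σ).map fun a => (M ^ Function.minimalPeriod σ a).trace).prod := by
  rw [labelSum, sum_prod_eq_prod_trace σ fun _ => M]
  simp

theorem kronecker_one_pow (M : Matrix I I ℂ) (k p : ℕ) :
    (M ⊗ₖ (1 : Matrix (Fin k) (Fin k) ℂ)) ^ p = (M ^ p) ⊗ₖ (1 : Matrix (Fin k) (Fin k) ℂ) := by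
  induction p with
  | zero => simp
  | succ p ih => rw [pow_succ, pow_succ, ih, ← Matrix.mul_kronecker_mul, one_mul]

/-- Each cycle contributes a factor `tr 1 = k`; hence integer weights per cycle amount to replacing
`M` by `k` diagonal copies of itself. -/
theorem labelSum_kronecker_one (M : Matrix I I ℂ) (k : ℕ) {m : ℕ} (σ : Equiv.Perm (Fin m)) :
    labelSum (M ⊗ₖ (1 : Matrix (Fin k) (Fin k) ℂ)) σ =
      (k : ℂ) ^ (cycleLeaders σ).length * labelSum M σ := by
  rw [labelSum_eq_prod_trace, labelSum_eq_prod_trace]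
  simp only [kronecker_one_pow, trace_kronecker, trace_one, Fintype.card_fin]
  rw [List.prod_map_mul, mul_comm]
  simp

/-- A labelling with a repeated value gives two equal rows, and each `m`-subset is the image of `m!`
injective labellings with the same minor. -/
theorem sum_det_submatrix (N : Matrix I I ℂ) (m : ℕ) :
    ∑ κ : Fin m → I, (N.submatrix κ κ).det =
      (m.factorial : ℂ) * ∑ s ∈ Finset.univ.powersetCard m,
        (N.submatrix (Subtype.val : s → I) (Subtype.val : s → I)).det := by
  classical
  have h0 : ∀ κ : Fin m → I, ¬ Function.Injective κ → (N.submatrix κ κ).det = 0 := by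
    intro κ hκ
    simp only [Function.Injective, not_forall] at hκ
    obtain ⟨i, j, hij, hne⟩ := hκ
    exact Matrix.det_zero_of_row_eq hne (by ext l; simp [hij])
  rw [← Finset.sum_filter_add_sum_filter_not _ (fun κ : Fin m → I => Function.Injective κ),
    Finset.sum_eq_zero (s := Finset.univ.filter fun κ : Fin m → I => ¬ Function.Injective κ)
      (fun κ hκ => h0 κ (Finset.mem_filter.1 hκ).2), add_zero,
    ← Finset.sum_fiberwise_of_maps_to (g := fun κ : Fin m → I => Finset.univ.image κ)
      (t := Finset.univ.powersetCard m), Finset.mul_sum]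
  · refine Finset.sum_congr rfl fun s hs => ?_
    have hs := (Finset.mem_powersetCard.1 hs).2
    have hcard : Fintype.card (Fin m ≃ s) = m.factorial := by
      rw [Fintype.card_equiv (Fintype.equivOfCardEq (by simp [hs]))]
      simp
    calc _ = ∑ e : Fin m ≃ s,
          (N.submatrix (Subtype.val : s → I) (Subtype.val : s → I)).det := by
          symm
          refine Finset.sum_bij (fun e _ => fun i => (e i : I)) ?_ ?_ ?_ ?_
          · intro e _
            simp only [Finset.mem_filter, Finset.mem_univ, true_and]
            refine ⟨Subtype.val_injective.comp e.injective, ?_⟩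
            ext x
            simp only [Finset.mem_image, Finset.mem_univ, true_and]
            constructor
            · rintro ⟨i, rfl⟩
              exact (e i).2
            · intro hx
              exact ⟨e.symm ⟨x, hx⟩, by simp⟩
          · intro e _ e' _ h
            ext i
            exact congrFun h i
          · intro κ hκ
            simp only [Finset.mem_filter, Finset.mem_univ, true_and] at hκ
            obtain ⟨hinj, him⟩ := hκ
            have hmem : ∀ i, κ i ∈ s := fun i => him ▸ Finset.mem_image_of_mem κ (Finset.mem_univ i)
            refine ⟨Equiv.ofBijective (fun i => ⟨κ i, hmem i⟩) ⟨?_, ?_⟩, Finset.mem_univ _, rfl⟩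
            · intro i j h
              exact hinj (congrArg Subtype.val h)
            · rintro ⟨x, hx⟩
              rw [← him] at hx
              obtain ⟨i, _, hi⟩ := Finset.mem_image.1 hx
              exact ⟨i, Subtype.ext hi⟩
          · intro e _
            rw [← Matrix.det_submatrix_equiv_self e, Matrix.submatrix_submatrix]
            rfl
      _ = _ := by simp [hcard]
  · intro κ hκ
    rw [Finset.mem_powersetCard]
    refine ⟨Finset.subset_univ _, ?_⟩
    rw [Finset.card_image_of_injective _ (Finset.mem_filter.1 hκ).2]
    simp

/-- The polynomial `det (1 + X M)`. -/
def detOneAdd (M : Matrix I I ℂ) : ℂ[X] := (1 + (X : ℂ[X]) • M.map C).det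

theorem sum_sign_mul_labelSum (N : Matrix I I ℂ) (m : ℕ) :
    ∑ σ : Equiv.Perm (Fin m), ((Equiv.Perm.sign σ : ℤ) : ℂ) * labelSum N σ =
      (m.factorial : ℂ) * (detOneAdd N).coeff m := by
  rw [detOneAdd, Matrix.coeff_det_one_add_X_smul_eq_sum_minors, ← sum_det_submatrix]
  simp only [labelSum, Finset.mul_sum]
  rw [Finset.sum_comm]
  refine Finset.sum_congr rfl fun κ _ => ?_
  rw [← Matrix.det_transpose, Matrix.det_apply']
  rfl

theorem detOneAdd_kronecker_one (M : Matrix I I ℂ) (k : ℕ) :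
    detOneAdd (M ⊗ₖ (1 : Matrix (Fin k) (Fin k) ℂ)) = detOneAdd M ^ k := by
  have : (1 + (X : ℂ[X]) • (M ⊗ₖ (1 : Matrix (Fin k) (Fin k) ℂ)).map C) =
      (1 + (X : ℂ[X]) • M.map C) ⊗ₖ (1 : Matrix (Fin k) (Fin k) ℂ[X]) := by
    rw [Matrix.add_kronecker, Matrix.one_kronecker_one]
    congr 1
    ext ⟨i, a⟩ ⟨j, b⟩ : 2
    by_cases h : a = b
    · simp [h]
    · simp [h]
  rw [detOneAdd, this, Matrix.det_kronecker]
  simp [detOneAdd]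

theorem alphaMinorSum_natCast (M : Matrix I I ℂ) (k m : ℕ) :
    alphaMinorSum M k m = (m.factorial : ℂ) * (detOneAdd M ^ k).coeff m := by
  rw [← detOneAdd_kronecker_one, ← sum_sign_mul_labelSum, alphaMinorSum]
  refine Finset.sum_congr rfl fun σ _ => ?_
  rw [labelSum_kronecker_one, mul_assoc]

/-- The generating function of the half-determinants is a square root of `det (1 + X M)`. -/
theorem sum_alphaMinorSum_half (M : Matrix I I ℂ) (m : ℕ) :
    ∑ p ∈ Finset.HasAntidiagonal.antidiagonal m,
      (alphaMinorSum M (1 / 2) p.1 / p.1.factorial) * (alphaMinorSum M (1 / 2) p.2 / p.2.factorial)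
      = (detOneAdd M).coeff m := by
  have hnat : ∀ k m : ℕ, (alphaMinorPoly M m).eval (k : ℂ) = (detOneAdd M ^ k).coeff m := by
    intro k m
    rw [eval_alphaMinorPoly, alphaMinorSum_natCast,
      mul_div_cancel_left₀ _ (Nat.cast_ne_zero.2 m.factorial_ne_zero)]
  -- Both sides are polynomials in `t` which agree at every natural number `k`, where the identity
  -- reads `D^k * D^k = D^(2k)` with `D = det (1 + X M)`. Evaluation at `1/2` then gives `D` itself.
  have hpoly : ∑ p ∈ Finset.HasAntidiagonal.antidiagonal m, alphaMinorPoly M p.1 * alphaMinorPoly M p.2 =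
      (alphaMinorPoly M m).comp (C 2 * X) := by
    refine Polynomial.eq_of_infinite_eval_eq _ _
      ((Set.infinite_range_of_injective (Nat.cast_injective (R := ℂ))).mono ?_)
    rintro _ ⟨k, rfl⟩
    simp only [Set.mem_ofPred_eq, eval_finsetSum, eval_mul, eval_comp, eval_C, eval_X, hnat]
    rw [← Polynomial.coeff_mul, ← pow_add, ← two_mul, ← hnat]
    simp
  have h := congrArg (Polynomial.eval (1 / 2 : ℂ)) hpoly
  simp only [eval_finsetSum, eval_mul, eval_comp, eval_C, eval_X, eval_alphaMinorPoly] at h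
  rw [h, mul_one_div_cancel two_ne_zero, ← eval_alphaMinorPoly]
  simpa using hnat 1 m

end AlphaDeterminant

/-! ### Complexified quaternions as complex `2 × 2` matrices -/

section QuaternionMatrices

open Matrix

/-- The isomorphism of the complexified quaternions with the complex `2 × 2` matrices. -/
def toMat : ℍ[ℂ] →+* Matrix (Fin 2) (Fin 2) ℂ where
  toFun q := !![q.re + q.imI * Complex.I, q.imJ + q.imK * Complex.I;
    -q.imJ + q.imK * Complex.I, q.re - q.imI * Complex.I]
  map_one' := by ext i j; fin_cases i <;> fin_cases j <;> simp
  map_zero' := by ext i j; fin_cases i <;> fin_cases j <;> simp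
  map_add' p q := by ext i j; fin_cases i <;> fin_cases j <;> simp <;> ring
  map_mul' p q := by
    ext i j
    fin_cases i <;> fin_cases j <;> simp [Matrix.mul_apply, Fin.sum_univ_two] <;> ring_nf <;>
      simp only [Complex.I_sq] <;> ring

theorem toMat_apply (q : ℍ[ℂ]) :
    toMat q = !![q.re + q.imI * Complex.I, q.imJ + q.imK * Complex.I;
      -q.imJ + q.imK * Complex.I, q.re - q.imI * Complex.I] := rfl

theorem trace_toMat (q : ℍ[ℂ]) : (toMat q).trace = 2 * q.re := by
  simp [toMat_apply, Matrix.trace, Fin.sum_univ_two]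
  ring

theorem toMat_smul (z : ℂ) (q : ℍ[ℂ]) : toMat (z • q) = z • toMat q := by
  ext i j
  fin_cases i <;> fin_cases j <;> simp [toMat_apply] <;> ring

/-- The inverse of `toMat`. -/
def ofMat (A : Matrix (Fin 2) (Fin 2) ℂ) : ℍ[ℂ] :=
  ⟨(A 0 0 + A 1 1) / 2, (A 1 1 - A 0 0) * Complex.I / 2, (A 0 1 - A 1 0) / 2,
    -(A 0 1 + A 1 0) * Complex.I / 2⟩

theorem ofMat_toMat (q : ℍ[ℂ]) : ofMat (toMat q) = q := by
  ext <;> simp [ofMat, toMat_apply] <;> ring_nf <;> simp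

theorem toMat_ofMat (A : Matrix (Fin 2) (Fin 2) ℂ) : toMat (ofMat A) = A := by
  have h1 : (A 0 0 + A 1 1) / 2 + (A 1 1 - A 0 0) * Complex.I / 2 * Complex.I = A 0 0 := by
    linear_combination (A 1 1 - A 0 0) / 2 * Complex.I_sq
  have h2 : (A 0 1 - A 1 0) / 2 + -(A 0 1 + A 1 0) * Complex.I / 2 * Complex.I = A 0 1 := by
    linear_combination -(A 0 1 + A 1 0) / 2 * Complex.I_sq
  have h3 : -((A 0 1 - A 1 0) / 2) + -(A 0 1 + A 1 0) * Complex.I / 2 * Complex.I = A 1 0 := by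
    linear_combination -(A 0 1 + A 1 0) / 2 * Complex.I_sq
  have h4 : (A 0 0 + A 1 1) / 2 - (A 1 1 - A 0 0) * Complex.I / 2 * Complex.I = A 1 1 := by
    linear_combination -(A 1 1 - A 0 0) / 2 * Complex.I_sq
  calc toMat (ofMat A) =
      !![(A 0 0 + A 1 1) / 2 + (A 1 1 - A 0 0) * Complex.I / 2 * Complex.I,
        (A 0 1 - A 1 0) / 2 + -(A 0 1 + A 1 0) * Complex.I / 2 * Complex.I;
        -((A 0 1 - A 1 0) / 2) + -(A 0 1 + A 1 0) * Complex.I / 2 * Complex.I,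
        (A 0 0 + A 1 1) / 2 - (A 1 1 - A 0 0) * Complex.I / 2 * Complex.I] := rfl
    _ = A := by rw [h1, h2, h3, h4]; exact (Matrix.eta_fin_two A).symm

theorem toMat_injective : Function.Injective toMat :=
  Function.LeftInverse.injective ofMat_toMat

/-- An entry of `toMat` as a linear form. -/
def toMatEntry (a b : Fin 2) : ℍ[ℂ] →ₗ[ℂ] ℂ where
  toFun q := toMat q a b
  map_add' p q := by simp
  map_smul' z q := by simp [toMat_smul]

/-- A many-factor form of `tr (FG) = tr (GF)`. The product `F i * G (σ i)` couples two points,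
whereas `G i * F i` involves a single one, so integration over the points factorizes. The label `κ
i` sits between `i` and `σ i`, whence `σ⁻¹`. -/
theorem sum_prod_mul_comm {m : ℕ} {S I R : Type*} [Fintype S] [Fintype I] [DecidableEq S]
    [DecidableEq I] [CommRing R] (σ : Equiv.Perm (Fin m)) (F : Fin m → Matrix S I R)
    (G : Fin m → Matrix I S R) :
    ∑ α : Fin m → S, ∏ i, (F i * G (σ i)) (α i) (α (σ i)) =
      ∑ κ : Fin m → I, ∏ i, (G i * F i) (κ (σ⁻¹ i)) (κ i) := by
  simp only [Matrix.mul_apply, Finset.prod_univ_sum, Fintype.piFinset_univ]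
  rw [Finset.sum_comm]
  refine Finset.sum_congr rfl fun κ _ => Finset.sum_congr rfl fun α _ => ?_
  rw [Finset.prod_mul_distrib, Finset.prod_mul_distrib, mul_comm]
  congr 1
  rw [← Equiv.prod_comp σ (fun i => G i (κ (σ⁻¹ i)) (α i))]
  simp

end QuaternionMatrices

/-! ### Coordinatewise integration of quaternion functions -/

section QuaternionIntegrals

variable {Λ : Type*} [MeasurableSpace Λ] {μ : Measure Λ}

theorem linearForm_apply_eq (L : ℍ[ℂ] →ₗ[ℂ] ℂ) (q : ℍ[ℂ]) :
    L q = q.re * L ⟨1, 0, 0, 0⟩ + q.imI * L ⟨0, 1, 0, 0⟩ + q.imJ * L ⟨0, 0, 1, 0⟩ +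
      q.imK * L ⟨0, 0, 0, 1⟩ := by
  have h : q = q.re • (⟨1, 0, 0, 0⟩ : ℍ[ℂ]) + q.imI • (⟨0, 1, 0, 0⟩ : ℍ[ℂ]) +
      q.imJ • (⟨0, 0, 1, 0⟩ : ℍ[ℂ]) + q.imK • (⟨0, 0, 0, 1⟩ : ℍ[ℂ]) := by
    ext <;> simp
  have h' : ∀ (a b c d : ℂ) (e₁ e₂ e₃ e₄ : ℍ[ℂ]), L (a • e₁ + b • e₂ + c • e₃ + d • e₄) =
      a * L e₁ + b * L e₂ + c * L e₃ + d * L e₄ := by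
    intros
    simp only [map_add, map_smul, smul_eq_mul]
  exact (congrArg L h).trans (h' _ _ _ _ _ _ _ _)

theorem QIntegrable.linearForm {u : Λ → ℍ[ℂ]} (hu : QIntegrable u μ) (L : ℍ[ℂ] →ₗ[ℂ] ℂ) :
    Integrable (fun x => L (u x)) μ := by
  obtain ⟨h1, h2, h3, h4⟩ := hu
  simp only [linearForm_apply_eq L (u _)]
  exact (((h1.mul_const _).add (h2.mul_const _)).add (h3.mul_const _)).add (h4.mul_const _)

theorem QIntegrable.integral_linearForm {u : Λ → ℍ[ℂ]} (hu : QIntegrable u μ)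
    (L : ℍ[ℂ] →ₗ[ℂ] ℂ) : ∫ x, L (u x) ∂μ = L (qIntegral u μ) := by
  obtain ⟨h1, h2, h3, h4⟩ := hu
  simp only [linearForm_apply_eq L (u _)]
  have a1 := h1.mul_const (L ⟨1, 0, 0, 0⟩)
  have a2 := h2.mul_const (L ⟨0, 1, 0, 0⟩)
  have a3 := h3.mul_const (L ⟨0, 0, 1, 0⟩)
  have a4 := h4.mul_const (L ⟨0, 0, 0, 1⟩)
  have b := integral_add ((a1.add a2).add a3) a4
  have b' := integral_add (a1.add a2) a3
  have b'' := integral_add a1 a2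
  simp only [Pi.add_apply, integral_mul_const] at b b' b''
  rw [b, b', b'', linearForm_apply_eq L (qIntegral u μ)]
  rfl

theorem QIntegrable.linearMap {u : Λ → ℍ[ℂ]} (hu : QIntegrable u μ) (T : ℍ[ℂ] →ₗ[ℂ] ℍ[ℂ]) :
    QIntegrable (fun x => T (u x)) μ ∧ qIntegral (fun x => T (u x)) μ = T (qIntegral u μ) := by
  let re : ℍ[ℂ] →ₗ[ℂ] ℂ := ⟨⟨fun q => q.re, by simp⟩, by simp⟩
  let imI : ℍ[ℂ] →ₗ[ℂ] ℂ := ⟨⟨fun q => q.imI, by simp⟩, by simp⟩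
  let imJ : ℍ[ℂ] →ₗ[ℂ] ℂ := ⟨⟨fun q => q.imJ, by simp⟩, by simp⟩
  let imK : ℍ[ℂ] →ₗ[ℂ] ℂ := ⟨⟨fun q => q.imK, by simp⟩, by simp⟩
  refine ⟨⟨hu.linearForm (re ∘ₗ T), hu.linearForm (imI ∘ₗ T), hu.linearForm (imJ ∘ₗ T),
    hu.linearForm (imK ∘ₗ T)⟩, ?_⟩
  ext
  · exact hu.integral_linearForm (re ∘ₗ T)
  · exact hu.integral_linearForm (imI ∘ₗ T)
  · exact hu.integral_linearForm (imJ ∘ₗ T)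
  · exact hu.integral_linearForm (imK ∘ₗ T)

theorem QIntegrable.mul_mul {u : Λ → ℍ[ℂ]} (hu : QIntegrable u μ) (p q : ℍ[ℂ]) :
    QIntegrable (fun x => p * u x * q) μ ∧
      qIntegral (fun x => p * u x * q) μ = p * qIntegral u μ * q :=
  hu.linearMap ⟨⟨fun x => p * x * q, fun x y => by rw [mul_add, add_mul]⟩,
    fun z x => by ext <;> simp <;> ring⟩

theorem QIntegrable.sum {ι : Type*} (s : Finset ι) {u : ι → Λ → ℍ[ℂ]}
    (hu : ∀ i ∈ s, QIntegrable (u i) μ) :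
    QIntegrable (fun x => ∑ i ∈ s, u i x) μ ∧
      qIntegral (fun x => ∑ i ∈ s, u i x) μ = ∑ i ∈ s, qIntegral (u i) μ := by
  classical
  induction s using Finset.induction_on with
  | empty => simp [QIntegrable, qIntegral]; rfl
  | insert i s hi ih =>
    obtain ⟨⟨h1, h2, h3, h4⟩, h⟩ := ih fun j hj => hu j (Finset.mem_insert_of_mem hj)
    obtain ⟨k1, k2, k3, k4⟩ := hu i (Finset.mem_insert_self _ _)
    simp only [Finset.sum_insert hi]
    rw [← h]
    refine ⟨⟨k1.add h1, k2.add h2, k3.add h3, k4.add h4⟩, ?_⟩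
    ext
    · exact integral_add k1 h1
    · exact integral_add k2 h2
    · exact integral_add k3 h3
    · exact integral_add k4 h4

theorem QMeasurable.sum {ι : Type*} (s : Finset ι) {u : ι → Λ → ℍ[ℂ]}
    (hu : ∀ i ∈ s, QMeasurable (u i)) : QMeasurable (fun x => ∑ i ∈ s, u i x) := by
  classical
  induction s using Finset.induction_on with
  | empty => simp [QMeasurable]
  | insert i s hi ih =>
    obtain ⟨h1, h2, h3, h4⟩ := ih fun j hj => hu j (Finset.mem_insert_of_mem hj)
    obtain ⟨k1, k2, k3, k4⟩ := hu i (Finset.mem_insert_self _ _)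
    simp only [Finset.sum_insert hi]
    exact ⟨k1.add h1, k2.add h2, k3.add h3, k4.add h4⟩

theorem QMeasurable.mul_const {u : Λ → ℍ[ℂ]} (hu : QMeasurable u) (q : ℍ[ℂ]) :
    QMeasurable (fun x => u x * q) := by
  obtain ⟨h1, h2, h3, h4⟩ := hu
  simp only [QMeasurable, Quaternion.re_mul, Quaternion.imI_mul, Quaternion.imJ_mul,
    Quaternion.imK_mul]
  refine ⟨?_, ?_, ?_, ?_⟩ <;> fun_prop

theorem qIntegral_congr_ae {u v : Λ → ℍ[ℂ]} (h : ∀ᵐ x ∂μ, u x = v x) :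
    qIntegral u μ = qIntegral v μ := by
  ext
  · exact integral_congr_ae (h.mono fun x hx => congrArg (·.re) hx)
  · exact integral_congr_ae (h.mono fun x hx => congrArg (·.imI) hx)
  · exact integral_congr_ae (h.mono fun x hx => congrArg (·.imJ) hx)
  · exact integral_congr_ae (h.mono fun x hx => congrArg (·.imK) hx)

theorem qIntegral_zero : qIntegral (fun _ : Λ => (0 : ℍ[ℂ])) μ = 0 := by
  ext <;> simp [qIntegral]

end QuaternionIntegrals

/-! ### Finite-rank kernels and their Gram matrices -/

section FiniteRank

open Matrix

variable {Λ : Type*} {r : ℕ} (f g : Fin r → Λ → ℍ[ℂ])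

/-- The functions `g_j^* f_k` as a complex matrix. -/
def gramFun (x : Λ) : Matrix (Fin r × Fin 2) (Fin r × Fin 2) ℂ :=
  Matrix.of fun p q => toMat (star (g p.1 x) * f q.1 x) p.2 q.2

/-- The integrals of the functions `g_j^* f_k` as a complex matrix. -/
def gramMatrix [MeasurableSpace Λ] (μ : Measure Λ) : Matrix (Fin r × Fin 2) (Fin r × Fin 2) ℂ :=
  Matrix.of fun p q => toMat (qIntegral (fun x => star (g p.1 x) * f q.1 x) μ) p.2 q.2

variable {f g}

/-- A scalar part is half the trace of the associated `2 × 2` matrix, which gives one factor `1/2`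
per cycle. -/
theorem prod_re_cycleProd {m : ℕ} (X : Matrix (Fin m) (Fin m) ℍ[ℂ]) (σ : Equiv.Perm (Fin m)) :
    ((cycleLeaders σ).map fun a => (cycleProd X σ a).re).prod =
      (1 / 2 : ℂ) ^ (cycleLeaders σ).length *
        ∑ α : Fin m → Fin 2, ∏ i, toMat (X i (σ i)) (α i) (α (σ i)) := by
  rw [sum_prod_eq_prod_trace σ fun i => toMat (X i (σ i))]
  have h : ∀ a, (cycleProd X σ a).re = 1 / 2 *
      ((List.range (Function.minimalPeriod σ a)).map
        fun s => toMat (X ((σ ^ s) a) (σ ((σ ^ s) a)))).prod.trace := by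
    intro a
    have := trace_toMat (cycleProd X σ a)
    rw [cycleProd, map_list_prod, List.map_map] at this
    simp only [Function.comp_def, pow_succ', Equiv.Perm.mul_apply] at this
    rw [this, cycleProd]
    simp only [pow_succ', Equiv.Perm.mul_apply]
    ring
  simp only [h]
  rw [List.prod_map_mul]
  simp

theorem toMat_kernel {K : Λ → Λ → ℍ[ℂ]} (hK : ∀ x y, K x y = ∑ k, f k x * star (g k y)) (x y : Λ) :
    toMat (K x y) =
      (Matrix.of fun a (p : Fin r × Fin 2) => toMat (f p.1 x) a p.2) *
      (Matrix.of fun (p : Fin r × Fin 2) b => toMat (star (g p.1 y)) p.2 b) := by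
  ext a b
  rw [hK, map_sum, Matrix.sum_apply, Matrix.mul_apply, Fintype.sum_prod_type]
  refine Finset.sum_congr rfl fun k _ => ?_
  rw [map_mul, Matrix.mul_apply]
  rfl

variable (f g) in
/-- The `m`-point function of a finite-rank kernel, in terms of the functions `g_j^* f_k`. -/
def pointFun {m : ℕ} (x : Fin m → Λ) : ℂ :=
  ∑ σ : Equiv.Perm (Fin m), ((Equiv.Perm.sign σ : ℤ) : ℂ) *
    ((1 / 2 : ℂ) ^ (cycleLeaders σ).length *
      ∑ κ : Fin m → Fin r × Fin 2, ∏ i, gramFun f g (x i) (κ (σ⁻¹ i)) (κ i))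

theorem mooreDet_kernel {K : Λ → Λ → ℍ[ℂ]} (hK : ∀ x y, K x y = ∑ k, f k x * star (g k y))
    (hsd : ∀ x y, K y x = star (K x y)) {m : ℕ} (x : Fin m → Λ) :
    mooreDet (Matrix.of fun i j => K (x i) (x j)) = ((pointFun f g x : ℂ) : ℍ[ℂ]) := by
  rw [mooreDet_eq_sum_re (X := Matrix.of fun i j => K (x i) (x j)) fun i j => hsd _ _, pointFun]
  congr 1
  refine Finset.sum_congr rfl fun σ _ => ?_
  rw [prod_re_cycleProd]
  congr 2
  simp only [Matrix.of_apply, toMat_kernel hK]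
  rw [sum_prod_mul_comm σ
    (fun i => Matrix.of fun a (p : Fin r × Fin 2) => toMat (f p.1 (x i)) a p.2)
    (fun i => Matrix.of fun (p : Fin r × Fin 2) b => toMat (star (g p.1 (x i))) p.2 b)]
  refine Finset.sum_congr rfl fun κ _ => Finset.prod_congr rfl fun i _ => ?_
  rw [gramFun, Matrix.of_apply, map_mul, Matrix.mul_apply, Matrix.mul_apply]
  rfl

variable [MeasurableSpace Λ] {μ : Measure Λ}

theorem integrable_gramFun (h : ∀ j k, QIntegrable (fun x => star (g j x) * f k x) μ)
    (p q : Fin r × Fin 2) : Integrable (fun x => gramFun f g x p q) μ :=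
  (h p.1 q.1).linearForm (toMatEntry p.2 q.2)

theorem integral_gramFun (h : ∀ j k, QIntegrable (fun x => star (g j x) * f k x) μ)
    (p q : Fin r × Fin 2) : ∫ x, gramFun f g x p q ∂μ = gramMatrix f g μ p q :=
  (h p.1 q.1).integral_linearForm (toMatEntry p.2 q.2)

theorem integrable_pointFun [SigmaFinite μ]
    (h : ∀ j k, QIntegrable (fun x => star (g j x) * f k x) μ) (m : ℕ) :
    Integrable (fun x : Fin m → Λ => pointFun f g x) (Measure.pi fun _ => μ) := by
  unfold pointFun
  refine integrable_finsetSum _ fun σ _ => Integrable.const_mul (Integrable.const_mul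
    (integrable_finsetSum _ fun κ _ => ?_) _) _
  exact Integrable.fintype_prod (f := fun i y => gramFun f g y (κ (σ⁻¹ i)) (κ i))
    fun i => integrable_gramFun h _ _

theorem integral_pointFun [SigmaFinite μ]
    (h : ∀ j k, QIntegrable (fun x => star (g j x) * f k x) μ) (m : ℕ) :
    ∫ x : Fin m → Λ, pointFun f g x ∂(Measure.pi fun _ => μ) =
      alphaMinorSum (gramMatrix f g μ) (1 / 2) m := by
  have hint : ∀ (σ : Equiv.Perm (Fin m)) (κ : Fin m → Fin r × Fin 2),
      Integrable (fun x : Fin m → Λ => ∏ i, gramFun f g (x i) (κ (σ⁻¹ i)) (κ i))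
        (Measure.pi fun _ => μ) := fun σ κ =>
    Integrable.fintype_prod (f := fun i y => gramFun f g y (κ (σ⁻¹ i)) (κ i))
      fun i => integrable_gramFun h _ _
  unfold pointFun
  rw [integral_finsetSum _ fun σ _ => ((integrable_finsetSum _ fun κ _ =>
    hint σ κ).const_mul _).const_mul _, alphaMinorSum]
  refine Finset.sum_congr rfl fun σ _ => ?_
  rw [integral_const_mul, integral_const_mul, integral_finsetSum _ fun κ _ => hint σ κ, labelSum,
    mul_assoc]
  congr 2
  refine Finset.sum_congr rfl fun κ _ => ?_
  rw [integral_fintype_prod_eq_prod fun i y => gramFun f g y (κ (σ⁻¹ i)) (κ i),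
    ← Equiv.prod_comp σ]
  simp [integral_gramFun h]

/-- The kernel acts on combinations `∑ f_k c_k` through the matrix of the integrals of `g_j^* f_k`.
Pairing such a combination with `g_j` returns `z c_j`; as `z ≠ 0`, it cannot vanish almost
everywhere unless `w = 0`. -/
theorem isEigenvalue_of_gramMatrix {K : Λ → Λ → ℍ[ℂ]}
    (hK : ∀ x y, K x y = ∑ k, f k x * star (g k y)) (hf : ∀ k, QMeasurable (f k))
    (h : ∀ j k, QIntegrable (fun x => star (g j x) * f k x) μ) {z : ℂ} (hz : z ≠ 0)
    {w : Fin r × Fin 2 → ℂ} (hw : w ≠ 0) (hzw : gramMatrix f g μ *ᵥ w = z • w) :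
    IsEigenvalue K μ z := by
  let G : Fin r → Fin r → ℍ[ℂ] := fun j k => qIntegral (fun x => star (g j x) * f k x) μ
  -- Left multiplication acts on the columns of a `2 × 2` matrix separately, so `w` fills one column
  -- and the other is zero.
  let c : Fin r → ℍ[ℂ] := fun k => ofMat !![w (k, 0), 0; w (k, 1), 0]
  have hc : ∀ k, toMat (c k) = !![w (k, 0), 0; w (k, 1), 0] := fun k => toMat_ofMat _
  have hc0 : ∀ k a, toMat (c k) a 0 = w (k, a) := by
    intro k a
    rw [hc]
    fin_cases a <;> rfl
  have hc1 : ∀ k a, toMat (c k) a 1 = 0 := by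
    intro k a
    rw [hc]
    fin_cases a <;> rfl
  have hGc : ∀ j, ∑ k, G j k * c k = z • c j := by
    intro j
    apply toMat_injective
    ext a b
    rw [map_sum, Matrix.sum_apply, toMat_smul, Matrix.smul_apply]
    simp only [map_mul, Matrix.mul_apply]
    fin_cases b
    · have := congrFun hzw (j, a)
      rw [Matrix.mulVec, dotProduct, Fintype.sum_prod_type] at this
      simpa [hc0, gramMatrix, G] using this
    · simp [hc1]
  have hgv : ∀ j x, star (g j x) * ∑ k, f k x * c k = ∑ k, 1 * (star (g j x) * f k x) * c k := by
    intro j x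
    rw [Finset.mul_sum]
    simp only [one_mul, mul_assoc]
  have hI : ∀ j, qIntegral (fun x => star (g j x) * ∑ k, f k x * c k) μ = z • c j := by
    intro j
    simp only [hgv]
    rw [(QIntegrable.sum _ fun k _ => ((h j k).mul_mul 1 (c k)).1).2, ← hGc]
    refine Finset.sum_congr rfl fun k _ => ?_
    rw [((h j k).mul_mul 1 (c k)).2, one_mul]
  have hI' : ∀ j, QIntegrable (fun x => star (g j x) * ∑ k, f k x * c k) μ := by
    intro j
    simp only [hgv]
    exact (QIntegrable.sum _ fun k _ => ((h j k).mul_mul 1 (c k)).1).1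
  refine ⟨fun x => ∑ k, f k x * c k, QMeasurable.sum _ fun k _ => (hf k).mul_const _, ?_, ?_⟩
  · intro h0
    apply hw
    ext ⟨j, a⟩
    have h1 : z • c j = 0 := by
      rw [← hI j, qIntegral_congr_ae (v := fun _ => 0), qIntegral_zero]
      filter_upwards [h0] with x hx
      rw [hx, mul_zero]
    have h2 : c j = 0 := by
      have : z⁻¹ • (z • c j) = 0 := by rw [h1, smul_zero]
      rwa [smul_smul, inv_mul_cancel₀ hz, one_smul] at this
    rw [← hc0, h2, map_zero]
    rfl
  · refine Eventually.of_forall fun x => ?_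
    have hKv : ∀ y, K x y * ∑ k, f k y * c k =
        ∑ j, f j x * (star (g j y) * ∑ k, f k y * c k) * 1 := by
      intro y
      rw [hK, Finset.sum_mul]
      simp only [mul_one, mul_assoc]
    simp only [hKv]
    have h3 := QIntegrable.sum (μ := μ) Finset.univ fun j _ => ((hI' j).mul_mul (f j x) 1).1
    refine ⟨h3.1, ?_⟩
    rw [h3.2, Finset.sum_mul]
    refine Finset.sum_congr rfl fun j _ => ?_
    rw [((hI' j).mul_mul (f j x) 1).2, hI, mul_one, mul_assoc]
    congr 1
    ext <;> simp [mul_comm]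

end FiniteRank

/-! ### Integer-valued variables with finitely many nonzero factorial moments -/

section FactorialMoments

theorem tsum_natCast_eq_top_or {α : Type*} (f : α → ℕ) :
    ∑' x, (f x : ℝ≥0∞) = ∞ ∨ ∃ k : ℕ, ∑' x, (f x : ℝ≥0∞) = k := by
  by_cases h : ∑' x, (f x : ℝ≥0∞) = ∞
  · exact Or.inl h
  · right
    have hfin := ENNReal.finite_const_le_of_tsum_ne_top h one_ne_zero
    refine ⟨∑ x ∈ hfin.toFinset, f x, ?_⟩
    rw [tsum_eq_sum (s := hfin.toFinset), Nat.cast_sum]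
    intro x hx
    have : ¬ (1 : ℝ≥0∞) ≤ f x := by simpa using hx
    have : f x = 0 := by
      by_contra h0
      exact this (by exact_mod_cast Nat.one_le_iff_ne_zero.2 h0)
    simp [this]

variable {Ω : Type*}

/-- The falling factorial of an extended nonnegative random variable. -/
def fallingFactorial (N : Ω → ℝ≥0∞) (m : ℕ) (ω : Ω) : ℝ≥0∞ :=
  ∏ j ∈ Finset.range m, (N ω - (j : ℝ≥0∞))

theorem fallingFactorial_of_eq_natCast {N : Ω → ℝ≥0∞} {ω : Ω} {k : ℕ} (h : N ω = k) (m : ℕ) :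
    fallingFactorial N m ω = (k.descFactorial m : ℝ≥0∞) := by
  rw [fallingFactorial, h, Nat.descFactorial_eq_prod_range, Nat.cast_prod]
  simp [ENNReal.natCast_sub]

variable [MeasurableSpace Ω]

theorem measurable_fallingFactorial {N : Ω → ℝ≥0∞} (hN : Measurable N) (m : ℕ) :
    Measurable (fallingFactorial N m) := by
  unfold fallingFactorial
  fun_prop

variable {P : Measure Ω} {N : Ω → ℝ≥0∞} {ρ : ℕ → ℝ} {r : ℕ}

theorem integrable_fallingFactorial (hN : Measurable N)
    (h : ∀ m, ∫⁻ ω, fallingFactorial N m ω ∂P = ENNReal.ofReal (ρ m)) (m : ℕ) :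
    Integrable (fun ω => (fallingFactorial N m ω).toReal) P :=
  integrable_toReal_of_lintegral_ne_top (measurable_fallingFactorial hN m).aemeasurable
    (by rw [h]; exact ENNReal.ofReal_ne_top)

theorem integral_fallingFactorial (hN : Measurable N) (hρ : ∀ m, 0 ≤ ρ m)
    (h : ∀ m, ∫⁻ ω, fallingFactorial N m ω ∂P = ENNReal.ofReal (ρ m)) (m : ℕ) :
    ∫ ω, (fallingFactorial N m ω).toReal ∂P = ρ m := by
  rw [integral_toReal (measurable_fallingFactorial hN m).aemeasurable, h,
    ENNReal.toReal_ofReal (hρ m)]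
  exact ae_lt_top (measurable_fallingFactorial hN m) (by rw [h]; exact ENNReal.ofReal_ne_top)

theorem integral_toReal_of_factorialMoments (hN : Measurable N) (hρ : ∀ m, 0 ≤ ρ m)
    (h : ∀ m, ∫⁻ ω, fallingFactorial N m ω ∂P = ENNReal.ofReal (ρ m)) :
    ∫ ω, (N ω).toReal ∂P = ρ 1 := by
  rw [← integral_fallingFactorial hN hρ h]
  simp [fallingFactorial]

/-- A finite first moment excludes the value `∞`; a vanishing factorial moment of order `r + 1` then
excludes integers above `r`. -/
theorem ae_le_of_factorialMoments (hN : Measurable N) (hval : ∀ ω, N ω = ∞ ∨ ∃ k : ℕ, N ω = k)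
    (h : ∀ m, ∫⁻ ω, fallingFactorial N m ω ∂P = ENNReal.ofReal (ρ m))
    (hr : ∀ m, r < m → ρ m = 0) : ∀ᵐ ω ∂P, ∃ k ≤ r, N ω = (k : ℕ) := by
  have h1 : ∀ᵐ ω ∂P, N ω < ∞ := by
    refine ae_lt_top hN ?_
    have := h 1
    simp only [fallingFactorial, Finset.range_one, Finset.prod_singleton, Nat.cast_zero,
      tsub_zero] at this
    rw [this]
    exact ENNReal.ofReal_ne_top
  have h2 := h (r + 1)
  rw [hr _ (Nat.lt_succ_self r), ENNReal.ofReal_zero,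
    lintegral_eq_zero_iff (measurable_fallingFactorial hN _)] at h2
  filter_upwards [h1, h2] with ω hω1 hω2
  obtain h | ⟨k, hk⟩ := hval ω
  · exact absurd h hω1.ne
  · refine ⟨k, ?_, hk⟩
    rw [fallingFactorial_of_eq_natCast hk] at hω2
    have : k.descFactorial (r + 1) = 0 := by
      rw [Pi.zero_apply] at hω2
      exact_mod_cast hω2
    rw [Nat.descFactorial_eq_zero_iff_lt] at this
    omega

/-- On `N = k` the binomial theorem expands `e^{itk} = ((e^{it} - 1) + 1)^k`, with falling
factorials over `m!` as coefficients. Terms with `k < m ≤ r` vanish, so one finite sum serves for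
all `k`. -/
theorem integral_exp_of_factorialMoments (hN : Measurable N)
    (hval : ∀ ω, N ω = ∞ ∨ ∃ k : ℕ, N ω = k) (hρ : ∀ m, 0 ≤ ρ m)
    (h : ∀ m, ∫⁻ ω, fallingFactorial N m ω ∂P = ENNReal.ofReal (ρ m))
    (hr : ∀ m, r < m → ρ m = 0) (t : ℝ) :
    ∫ ω, Complex.exp (t * (N ω).toReal * Complex.I) ∂P =
      ∑ m ∈ Finset.range (r + 1),
        ((ρ m / m.factorial : ℝ) : ℂ) * (Complex.exp (t * Complex.I) - 1) ^ m := by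
  have hae : ∀ᵐ ω ∂P, Complex.exp (t * (N ω).toReal * Complex.I) =
      ∑ m ∈ Finset.range (r + 1), (((fallingFactorial N m ω).toReal : ℝ) : ℂ) *
        ((Complex.exp (t * Complex.I) - 1) ^ m / m.factorial) := by
    filter_upwards [ae_le_of_factorialMoments hN hval h hr] with ω hω
    obtain ⟨k, hk, hkN⟩ := hω
    have h1 : Complex.exp (t * (N ω).toReal * Complex.I) =
        ((Complex.exp (t * Complex.I) - 1) + 1) ^ k := by
      rw [sub_add_cancel, ← Complex.exp_nat_mul, hkN]
      congr 1
      simp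
      ring
    rw [h1, add_pow]
    have h2 : Finset.range (k + 1) ⊆ Finset.range (r + 1) :=
      Finset.range_subset_range.2 (by omega)
    rw [← Finset.sum_subset h2]
    · refine Finset.sum_congr rfl fun m _ => ?_
      rw [fallingFactorial_of_eq_natCast hkN, Nat.descFactorial_eq_factorial_mul_choose]
      have : (m.factorial : ℂ) ≠ 0 := Nat.cast_ne_zero.2 m.factorial_ne_zero
      simp
      field_simp
    · intro m _ hm
      have : k < m := by simpa using hm
      rw [fallingFactorial_of_eq_natCast hkN, Nat.descFactorial_of_lt this]
      simp
  have hi : ∀ m ∈ Finset.range (r + 1), Integrable (fun ω =>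
      (((fallingFactorial N m ω).toReal : ℝ) : ℂ) *
        ((Complex.exp (t * Complex.I) - 1) ^ m / m.factorial)) P := fun m _ =>
    ((integrable_fallingFactorial hN h m).ofReal (𝕜 := ℂ)).mul_const _
  rw [integral_congr_ae hae, integral_finsetSum _ hi]
  refine Finset.sum_congr rfl fun m _ => ?_
  rw [integral_mul_const, integral_complex_ofReal, integral_fallingFactorial hN hρ h]
  push_cast
  ring

variable [IsProbabilityMeasure P]

theorem memLp_toReal_of_factorialMoments (hN : Measurable N)
    (hval : ∀ ω, N ω = ∞ ∨ ∃ k : ℕ, N ω = k)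
    (h : ∀ m, ∫⁻ ω, fallingFactorial N m ω ∂P = ENNReal.ofReal (ρ m))
    (hr : ∀ m, r < m → ρ m = 0) : MemLp (fun ω => (N ω).toReal) 2 P := by
  refine MemLp.of_bound hN.ennreal_toReal.aestronglyMeasurable r ?_
  filter_upwards [ae_le_of_factorialMoments hN hval h hr] with ω hω
  obtain ⟨k, hk, hkN⟩ := hω
  simpa [hkN] using hk

theorem variance_toReal_of_factorialMoments (hN : Measurable N)
    (hval : ∀ ω, N ω = ∞ ∨ ∃ k : ℕ, N ω = k) (hρ : ∀ m, 0 ≤ ρ m)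
    (h : ∀ m, ∫⁻ ω, fallingFactorial N m ω ∂P = ENNReal.ofReal (ρ m))
    (hr : ∀ m, r < m → ρ m = 0) :
    variance (fun ω => (N ω).toReal) P = ρ 2 + ρ 1 - ρ 1 ^ 2 := by
  rw [variance_eq_sub (memLp_toReal_of_factorialMoments hN hval h hr),
    integral_toReal_of_factorialMoments hN hρ h]
  congr 1
  rw [← integral_fallingFactorial hN hρ h 2, ← integral_fallingFactorial hN hρ h 1,
    ← integral_add (integrable_fallingFactorial hN h 2) (integrable_fallingFactorial hN h 1)]
  refine integral_congr_ae ?_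
  filter_upwards [ae_le_of_factorialMoments hN hval h hr] with ω hω
  obtain ⟨k, hk, hkN⟩ := hω
  rw [fallingFactorial_of_eq_natCast hkN, fallingFactorial_of_eq_natCast hkN]
  simp only [Pi.pow_apply, hkN, ENNReal.toReal_natCast]
  rw [← Nat.cast_add, ← Nat.cast_pow]
  congr 1
  cases k with
  | zero => simp
  | succ k => simp [Nat.descFactorial]; ring

end FactorialMoments

/-! ### Factorization of a polynomial with constant term one -/

section PolynomialRoots

open Polynomial

/-- These coefficients are elementary symmetric functions of the `ν j`; they encode the mean and the
variance. -/
theorem coeff_prod_one_add {ι R : Type*} [CommRing R] (s : Finset ι) (ν : ι → R) :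
    (∏ j ∈ s, (1 + C (ν j) * X)).coeff 0 = 1 ∧ (∏ j ∈ s, (1 + C (ν j) * X)).coeff 1 = ∑ j ∈ s, ν j ∧
      2 * (∏ j ∈ s, (1 + C (ν j) * X)).coeff 2 = (∑ j ∈ s, ν j) ^ 2 - ∑ j ∈ s, ν j ^ 2 := by
  classical
  induction s using Finset.induction_on with
  | empty => simp [coeff_one]
  | insert i s hi ih =>
    obtain ⟨h0, h1, h2⟩ := ih
    rw [Finset.prod_insert hi, Finset.sum_insert hi, Finset.sum_insert hi]
    simp only [add_mul, one_mul, mul_assoc, coeff_add, coeff_C_mul, coeff_X_mul, coeff_X_mul_zero,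
      h0, h1, mul_add, h2]
    refine ⟨by simp, by ring, by ring⟩

/-- Each linear factor is `X - a = -a (1 + ν X)` with `ν = -a⁻¹`; the collected constant equals one
by comparison of constant terms. -/
theorem eq_prod_one_add_of_coeff_zero {F : ℂ[X]} (h0 : F.coeff 0 = 1)
    (hroot : ∀ a, F.IsRoot a → ∃ t : ℝ, 0 ≤ t ∧ t ≤ 1 ∧ -a⁻¹ = (t : ℂ)) :
    ∃ (d : ℕ) (ν : Fin d → ℝ), (∀ j, 0 ≤ ν j ∧ ν j ≤ 1) ∧
      F = ∏ j, (1 + C ((ν j : ℝ) : ℂ) * X) := by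
  have hF0 : F ≠ 0 := by
    rintro rfl
    simp at h0
  obtain ⟨l, hl⟩ := Quot.exists_rep F.roots
  have hl : F.roots = (l : Multiset ℂ) := hl.symm
  have hmem : ∀ j : Fin l.length, F.IsRoot (l.get j) := fun j => by
    rw [← mem_roots hF0, hl]
    exact List.get_mem l j
  choose ν hν0 hν1 hν using fun j => hroot _ (hmem j)
  have hne : ∀ j, l.get j ≠ 0 := by
    intro j hj
    have := hmem j
    rw [hj, IsRoot.def, ← coeff_zero_eq_eval_zero, h0] at this
    exact one_ne_zero this
  refine ⟨l.length, ν, fun j => ⟨hν0 j, hν1 j⟩, ?_⟩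
  have hprod : F = C F.leadingCoeff * ∏ j, (X - C (l.get j)) := by
    conv_lhs => rw [(IsAlgClosed.splits F).eq_prod_roots]
    rw [hl, Multiset.map_coe, Multiset.prod_coe, ← Fin.prod_univ_fun_getElem]
    rfl
  have hfac : ∀ j, (X - C (l.get j) : ℂ[X]) = C (-l.get j) * (1 + C ((ν j : ℝ) : ℂ) * X) := by
    intro j
    rw [← hν j, mul_add, ← mul_assoc, ← C_mul]
    have : -l.get j * -(l.get j)⁻¹ = 1 := by
      have := hne j
      field_simp
    rw [this]
    simp
    ring
  have hF : F = C (F.leadingCoeff * ∏ j, -l.get j) * ∏ j, (1 + C ((ν j : ℝ) : ℂ) * X) := by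
    conv_lhs => rw [hprod]
    simp only [hfac]
    rw [Finset.prod_mul_distrib, C_mul, ← mul_assoc, map_prod]
  have hc : F.leadingCoeff * ∏ j, -l.get j = 1 := by
    have := congrArg (fun G : ℂ[X] => G.coeff 0) hF
    simp only [coeff_C_mul, (coeff_prod_one_add Finset.univ fun j => ((ν j : ℝ) : ℂ)).1, h0] at this
    rw [mul_one] at this
    exact this.symm
  rw [hF, hc, C_1, one_mul]

end PolynomialRoots

/-! ### Bernoulli form of the number of points -/

section BernoulliParameters

open Polynomial Matrix

theorem natDegree_detOneAdd_le {I : Type*} [Fintype I] [DecidableEq I] (M : Matrix I I ℂ) :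
    (detOneAdd M).natDegree ≤ Fintype.card I := by
  have := Polynomial.natDegree_det_X_add_C_le M (1 : Matrix I I ℂ)
  rwa [Matrix.map_one _ C_0 C_1, add_comm] at this

theorem exists_mulVec_eq_of_isRoot_detOneAdd {I : Type*} [Fintype I] [DecidableEq I]
    {M : Matrix I I ℂ} {a : ℂ} (ha : (detOneAdd M).IsRoot a) (ha0 : a ≠ 0) :
    ∃ w : I → ℂ, w ≠ 0 ∧ M *ᵥ w = (-a⁻¹) • w := by
  have hdet : (1 + a • M).det = 0 := by
    rw [IsRoot.def, detOneAdd, ← coe_evalRingHom, RingHom.map_det] at ha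
    rw [← ha]
    congr 1
    ext i j
    simp [Matrix.one_apply, apply_ite (Polynomial.eval a)]
    exact mul_comm _ _
  obtain ⟨w, hw, hw0⟩ := Matrix.exists_mulVec_eq_zero_iff.2 hdet
  refine ⟨w, hw, ?_⟩
  rw [Matrix.add_mulVec, Matrix.one_mulVec, Matrix.smul_mulVec] at hw0
  have h1 : a⁻¹ • (w + a • M *ᵥ w) = 0 := by rw [hw0, smul_zero]
  rw [smul_add, smul_smul, inv_mul_cancel₀ ha0, one_smul] at h1
  rw [neg_smul]
  exact eq_neg_of_add_eq_zero_right h1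

theorem alphaMinorSum_zero {I : Type*} [Fintype I] (M : Matrix I I ℂ) (t : ℂ) :
    alphaMinorSum M t 0 = 1 := by
  simp [alphaMinorSum, labelSum, cycleLeaders]

theorem Configuration.measurable_count {Λ : Type*} [MeasurableSpace Λ] {A : Set Λ}
    (hA : MeasurableSet A) : Measurable fun c : Configuration Λ => c.count A :=
  Measurable.of_comap_le (le_iSup₂_of_le A hA le_rfl)

theorem Configuration.count_eq_top_or {Λ : Type*} (c : Configuration Λ) (A : Set Λ) :
    c.count A = ∞ ∨ ∃ k : ℕ, c.count A = k :=
  tsum_natCast_eq_top_or fun x : A => c.mult x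

variable {Λ : Type*} [MeasurableSpace Λ] {μ : Measure Λ} {P : Measure (Configuration Λ)}

theorem IsCorrelationFunction.lintegral_fallingFactorial {m : ℕ} {R : (Fin m → Λ) → ℝ≥0}
    (hR : IsCorrelationFunction P μ m R) :
    ∫⁻ c, fallingFactorial (fun c : Configuration Λ => c.count Set.univ) m c ∂P =
      ∫⁻ x, (R x : ℝ≥0∞) ∂(Measure.pi fun _ => μ) := by
  have h := hR.2 1 (fun _ => Set.univ) (fun _ => m) (by simp) (fun _ => MeasurableSet.univ)
    (fun i j hij => absurd (Subsingleton.elim i j) hij)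
  simpa [fallingFactorial] using h

variable [SigmaFinite μ] [IsProbabilityMeasure P] {r : ℕ} {f g : Fin r → Λ → ℍ[ℂ]}
  {K : Λ → Λ → ℍ[ℂ]}

theorem IsPfaffianField.exists_factorialMoment (hPf : IsPfaffianField P μ K)
    (hK : ∀ x y, K x y = ∑ k, f k x * star (g k y))
    (h : ∀ j k, QIntegrable (fun x => star (g j x) * f k x) μ) (m : ℕ) :
    ∃ ρ : ℝ, 0 ≤ ρ ∧ (ρ : ℂ) = alphaMinorSum (gramMatrix f g μ) (1 / 2) m ∧
      ∫⁻ c, fallingFactorial (fun c : Configuration Λ => c.count Set.univ) m c ∂P =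
        ENNReal.ofReal ρ := by
  -- Correlation functions are given only for `m ≥ 1`; the moment of order zero is the total mass.
  obtain rfl | hm := Nat.eq_zero_or_pos m
  · exact ⟨1, zero_le_one, by simp [alphaMinorSum_zero], by simp [fallingFactorial]⟩
  obtain ⟨R, hR, hRK⟩ := hPf.2 m hm
  have hRp : ∀ᵐ x ∂(Measure.pi fun _ : Fin m => μ), (((R x : ℝ) : ℂ)) = pointFun f g x := by
    filter_upwards [hRK] with x hx
    rw [mooreDet_kernel hK hPf.1] at hx
    exact congrArg (fun q : ℍ[ℂ] => q.re) hx
  have hRi : Integrable (fun x => ((R x : ℝ) : ℂ)) (Measure.pi fun _ : Fin m => μ) :=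
    (integrable_congr hRp).2 (integrable_pointFun h m)
  have hRr : Integrable (fun x => (R x : ℝ)) (Measure.pi fun _ : Fin m => μ) := by
    simpa using hRi.re
  refine ⟨∫ x, (R x : ℝ) ∂(Measure.pi fun _ : Fin m => μ),
    integral_nonneg fun x => (R x).coe_nonneg, ?_, ?_⟩
  · rw [← integral_pointFun h, ← integral_congr_ae hRp, integral_complex_ofReal]
  · rw [hR.lintegral_fallingFactorial,
      ofReal_integral_eq_lintegral_ofReal hRr (Eventually.of_forall fun x => (R x).coe_nonneg)]
    simp

/-- The number of points of a Pfaffian field with a finite-rank kernel whose eigenvalues lie in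
`[0, 1]` is distributed as a sum of independent Bernoulli variables. -/
theorem IsPfaffianField.exists_bernoulli_parameters (hPf : IsPfaffianField P μ K)
    (hrank : IsFiniteRank K μ)
    (heig : ∀ z : ℂ, IsEigenvalue K μ z → ∃ t : ℝ, 0 ≤ t ∧ t ≤ 1 ∧ z = (t : ℂ)) :
    (∀ᵐ c ∂P, c.count Set.univ ≠ ∞) ∧ MemLp numPoints 2 P ∧
      ∃ (d : ℕ) (ν : Fin d → ℝ), (∀ j, 0 ≤ ν j ∧ ν j ≤ 1) ∧
        ∫ c, numPoints c ∂P = ∑ j, ν j ∧ variance numPoints P = ∑ j, ν j * (1 - ν j) ∧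
        ∀ t : ℝ, ∫ c, Complex.exp (t * numPoints c * Complex.I) ∂P =
          ∏ j, (1 + ν j * (Complex.exp (t * Complex.I) - 1)) := by
  obtain ⟨r, f, g, hf, -, hfg, hK⟩ := hrank
  set M := gramMatrix f g μ
  choose ρ hρ hρM hmom using hPf.exists_factorialMoment hK hfg
  have hN : Measurable fun c : Configuration Λ => c.count Set.univ :=
    Configuration.measurable_count MeasurableSet.univ
  have hval := fun c : Configuration Λ => c.count_eq_top_or Set.univ
  have hsq : ∀ m, ∑ p ∈ Finset.HasAntidiagonal.antidiagonal m,
      ((ρ p.1 / p.1.factorial * (ρ p.2 / p.2.factorial) : ℝ) : ℂ) = (detOneAdd M).coeff m := by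
    intro m
    rw [← sum_alphaMinorSum_half]
    refine Finset.sum_congr rfl fun p _ => ?_
    push_cast
    rw [hρM, hρM]
  -- Coefficient `2m` of the determinant vanishes, since its degree is at most `2r`. It is a sum of
  -- nonnegative terms, one of which is `(ρ m / m!)²`.
  have hr : ∀ m, r < m → ρ m = 0 := by
    intro m hm
    have h0 : (detOneAdd M).coeff (m + m) = 0 := by
      refine coeff_eq_zero_of_natDegree_lt ((natDegree_detOneAdd_le M).trans_lt ?_)
      simp
      omega
    have h1 := hsq (m + m)
    rw [h0, ← Complex.ofReal_sum, Complex.ofReal_eq_zero, Finset.sum_eq_zero_iff_of_nonneg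
      (fun p _ => mul_nonneg (div_nonneg (hρ _) (Nat.cast_nonneg _))
        (div_nonneg (hρ _) (Nat.cast_nonneg _)))] at h1
    have h2 := h1 (m, m) (by simp)
    have : (m.factorial : ℝ) ≠ 0 := Nat.cast_ne_zero.2 m.factorial_ne_zero
    simpa [this] using h2
  let F : ℂ[X] := ∑ m ∈ Finset.range (r + 1), C ((ρ m / m.factorial : ℝ) : ℂ) * X ^ m
  have hcoeff : ∀ m, F.coeff m = ((ρ m / m.factorial : ℝ) : ℂ) := by
    intro m
    simp only [F, finsetSum_coeff, coeff_C_mul_X_pow]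
    rw [Finset.sum_ite_eq]
    split_ifs with h
    · rfl
    · rw [hr m (by simpa using h)]
      simp
  have hFsq : F ^ 2 = detOneAdd M := by
    ext m
    rw [sq, coeff_mul, ← hsq]
    refine Finset.sum_congr rfl fun p _ => ?_
    rw [hcoeff, hcoeff, Complex.ofReal_mul]
  have hF0 : F.coeff 0 = 1 := by
    rw [hcoeff]
    push_cast
    rw [hρM, alphaMinorSum_zero]
    simp
  -- A root `a` of `F` is a root of `F² = det (1 + X M)`, so `-a⁻¹` is a nonzero eigenvalue of `M`
  -- and therefore of `K`.
  obtain ⟨d, ν, hν, hFν⟩ := eq_prod_one_add_of_coeff_zero hF0 (by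
    intro a ha
    have ha0 : a ≠ 0 := by
      rintro rfl
      rw [IsRoot.def, ← coeff_zero_eq_eval_zero, hF0] at ha
      exact one_ne_zero ha
    obtain ⟨w, hw, hMw⟩ := exists_mulVec_eq_of_isRoot_detOneAdd (M := M) (a := a) (by
      rw [IsRoot.def, ← hFsq, eval_pow, ha.eq_zero]
      simp) ha0
    exact heig _ (isEigenvalue_of_gramMatrix hK hf hfg (neg_ne_zero.2 (inv_ne_zero ha0)) hw hMw))
  have hc := coeff_prod_one_add Finset.univ fun j => ((ν j : ℝ) : ℂ)
  rw [← hFν, hcoeff, hcoeff, hcoeff] at hc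
  have h1 : ρ 1 = ∑ j, ν j := by
    have := hc.2.1
    simp only [Nat.factorial_one, Nat.cast_one, div_one] at this
    exact_mod_cast this
  have h2 : ρ 2 = (∑ j, ν j) ^ 2 - ∑ j, ν j ^ 2 := by
    have h := hc.2.2
    rw [← Complex.ofReal_ofNat, ← Complex.ofReal_mul] at h
    have h' : 2 * (ρ 2 / (Nat.factorial 2 : ℕ)) = (∑ j, ν j) ^ 2 - ∑ j, ν j ^ 2 := by
      exact_mod_cast h
    rw [← h']
    simp
    ring
  refine ⟨?_, memLp_toReal_of_factorialMoments hN hval hmom hr, d, ν, hν, ?_, ?_, ?_⟩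
  · filter_upwards [ae_le_of_factorialMoments hN hval hmom hr] with c hc
    obtain ⟨k, -, hk⟩ := hc
    simp [hk]
  · rw [← h1]
    exact integral_toReal_of_factorialMoments hN hρ hmom
  · refine (variance_toReal_of_factorialMoments hN hval hρ hmom hr).trans ?_
    rw [h1, h2]
    simp only [mul_sub, Finset.sum_sub_distrib, mul_one, sq]
    ring
  · intro t
    refine (integral_exp_of_factorialMoments hN hval hρ hmom hr t).trans ?_
    have := congrArg (Polynomial.eval (Complex.exp (t * Complex.I) - 1)) hFν
    simpa [F, eval_finsetSum, eval_prod] using this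

end BernoulliParameters

/-! ### Gaussian approximation of products of Bernoulli characteristic functions -/

section CentralLimit

/-- Factors are exchanged one at a time; all the others have norm at most one. -/
theorem norm_prod_sub_prod_le {ι : Type*} (s : Finset ι) {a b : ι → ℂ} (ha : ∀ i, ‖a i‖ ≤ 1)
    (hb : ∀ i, ‖b i‖ ≤ 1) : ‖∏ i ∈ s, a i - ∏ i ∈ s, b i‖ ≤ ∑ i ∈ s, ‖a i - b i‖ := by
  classical
  induction s using Finset.induction_on with
  | empty => simp
  | insert i s hi ih =>
    rw [Finset.prod_insert hi, Finset.prod_insert hi, Finset.sum_insert hi]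
    have h1 : ‖∏ j ∈ s, b j‖ ≤ 1 := by
      rw [norm_prod]
      exact Finset.prod_le_one (fun j _ => norm_nonneg _) fun j _ => hb j
    calc ‖a i * ∏ j ∈ s, a j - b i * ∏ j ∈ s, b j‖
        = ‖a i * (∏ j ∈ s, a j - ∏ j ∈ s, b j) + (a i - b i) * ∏ j ∈ s, b j‖ := by
          congr 1; ring
      _ ≤ ‖a i‖ * ‖∏ j ∈ s, a j - ∏ j ∈ s, b j‖ + ‖a i - b i‖ * ‖∏ j ∈ s, b j‖ := by
          rw [← norm_mul, ← norm_mul]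
          exact norm_add_le _ _
      _ ≤ 1 * ∑ j ∈ s, ‖a j - b j‖ + ‖a i - b i‖ * 1 := by
          gcongr
          exact ha i
      _ = _ := by ring

theorem norm_exp_ofReal_mul_I_sub_le {x : ℝ} (hx : |x| ≤ 1) :
    ‖Complex.exp (x * Complex.I) - (1 + x * Complex.I - x ^ 2 / 2)‖ ≤ |x| ^ 3 := by
  have hn : ‖(x : ℂ) * Complex.I‖ = |x| := by simp
  have h := Complex.exp_bound (x := x * Complex.I) (by rwa [hn]) (n := 3) (by norm_num)
  rw [hn] at h
  have h2 : ∑ m ∈ Finset.range 3, ((x : ℂ) * Complex.I) ^ m / (m.factorial : ℂ) =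
      1 + x * Complex.I - x ^ 2 / 2 := by
    simp [Finset.sum_range_succ, mul_pow, Nat.factorial]
    ring
  rw [h2] at h
  -- The remainder constant at order three is `4 / (3! * 3) = 2/9`.
  refine h.trans (mul_le_of_le_one_right (by positivity) ?_)
  norm_num [Nat.factorial]

/-- The characteristic function of a centered Bernoulli variable. -/
def centeredBernoulliCharFun (ν u : ℝ) : ℂ :=
  (1 + ν * (Complex.exp (u * Complex.I) - 1)) * Complex.exp (-(ν * u) * Complex.I)

theorem centeredBernoulliCharFun_eq (ν u : ℝ) :
    centeredBernoulliCharFun ν u =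
      ((1 - ν : ℝ) : ℂ) * Complex.exp ((-(ν * u) : ℝ) * Complex.I) +
        (ν : ℂ) * Complex.exp (((1 - ν) * u : ℝ) * Complex.I) := by
  have h : Complex.exp (((1 - ν) * u : ℝ) * Complex.I) =
      Complex.exp (u * Complex.I) * Complex.exp (-(ν * u) * Complex.I) := by
    rw [← Complex.exp_add]
    congr 1
    push_cast
    ring
  rw [h, centeredBernoulliCharFun]
  push_cast
  ring

variable {ν u : ℝ}

theorem norm_centeredBernoulliCharFun_le (h0 : 0 ≤ ν) (h1 : ν ≤ 1) :
    ‖centeredBernoulliCharFun ν u‖ ≤ 1 := by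
  rw [centeredBernoulliCharFun_eq]
  refine (norm_add_le _ _).trans ?_
  rw [norm_mul, norm_mul, Complex.norm_exp_ofReal_mul_I, Complex.norm_exp_ofReal_mul_I,
    Complex.norm_real, Complex.norm_real, Real.norm_of_nonneg h0,
    Real.norm_of_nonneg (by linarith)]
  linarith

/-- To second order both terms equal `1 - v u² / 2` with `v = ν (1 - ν)`. The cubic remainders of
the two atoms and the remainder of the real exponential contribute at most `v |u|³` each. The factor
`v` is essential, as it sums to the variance. -/
theorem norm_centeredBernoulliCharFun_sub_exp_le (h0 : 0 ≤ ν) (h1 : ν ≤ 1) (hu : |u| ≤ 1) :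
    ‖centeredBernoulliCharFun ν u - ((Real.exp (-(ν * (1 - ν) * u ^ 2 / 2)) : ℝ) : ℂ)‖ ≤
      2 * (ν * (1 - ν)) * |u| ^ 3 := by
  have h1' : 0 ≤ 1 - ν := by linarith
  have hu0 := abs_nonneg u
  have habs1 : |-(ν * u)| = ν * |u| := by rw [abs_neg, abs_mul, abs_of_nonneg h0]
  have habs2 : |(1 - ν) * u| = (1 - ν) * |u| := by rw [abs_mul, abs_of_nonneg h1']
  have e1 := norm_exp_ofReal_mul_I_sub_le (x := -(ν * u)) (by rw [habs1]; nlinarith)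
  have e2 := norm_exp_ofReal_mul_I_sub_le (x := (1 - ν) * u) (by rw [habs2]; nlinarith)
  rw [habs1] at e1
  rw [habs2] at e2
  have hv0 : 0 ≤ ν * (1 - ν) := mul_nonneg h0 h1'
  have hv1 : ν * (1 - ν) ≤ 1 := by nlinarith
  have hu2 : u ^ 2 ≤ 1 := by rw [← sq_abs]; nlinarith
  set v := ν * (1 - ν) with hv
  have hy : |-(v * u ^ 2 / 2)| ≤ 1 := by
    rw [abs_neg, abs_of_nonneg (by positivity)]
    nlinarith [sq_nonneg u]
  have e3 : |Real.exp (-(v * u ^ 2 / 2)) - (1 - v * u ^ 2 / 2)| ≤ v * |u| ^ 3 := by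
    have h := Real.abs_exp_sub_one_sub_id_le hy
    rw [sub_sub, ← sub_eq_add_neg] at h
    refine h.trans ?_
    have : (-(v * u ^ 2 / 2)) ^ 2 = v * |u| ^ 3 * (v * |u| / 4) := by
      rw [← sq_abs u]
      ring
    rw [this]
    refine mul_le_of_le_one_right (by positivity) ?_
    nlinarith
  have hsplit : centeredBernoulliCharFun ν u - ((Real.exp (-(v * u ^ 2 / 2)) : ℝ) : ℂ) =
      ((1 - ν : ℝ) : ℂ) * (Complex.exp ((-(ν * u) : ℝ) * Complex.I) -
        (1 + (-(ν * u) : ℝ) * Complex.I - ((-(ν * u) : ℝ) : ℂ) ^ 2 / 2)) +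
      (ν : ℂ) * (Complex.exp (((1 - ν) * u : ℝ) * Complex.I) -
        (1 + ((1 - ν) * u : ℝ) * Complex.I - (((1 - ν) * u : ℝ) : ℂ) ^ 2 / 2)) -
      ((Real.exp (-(v * u ^ 2 / 2)) - (1 - v * u ^ 2 / 2) : ℝ) : ℂ) := by
    rw [centeredBernoulliCharFun_eq, hv]
    push_cast
    ring
  rw [hsplit]
  refine (norm_sub_le _ _).trans ((add_le_add_left (norm_add_le _ _) _).trans ?_)
  rw [norm_mul, norm_mul, Complex.norm_real, Complex.norm_real, Complex.norm_real,
    Real.norm_of_nonneg h0, Real.norm_of_nonneg h1', Real.norm_eq_abs]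
  calc _ ≤ (1 - ν) * (ν * |u|) ^ 3 + ν * ((1 - ν) * |u|) ^ 3 + v * |u| ^ 3 := by gcongr
    _ = (v * |u| ^ 3) * (ν ^ 2 + (1 - ν) ^ 2) + v * |u| ^ 3 := by rw [hv]; ring
    _ ≤ (v * |u| ^ 3) * 1 + v * |u| ^ 3 := by
        gcongr
        nlinarith
    _ = _ := by ring

theorem norm_prod_centeredBernoulliCharFun_sub_le {d : ℕ} {ν : Fin d → ℝ}
    (hν : ∀ j, 0 ≤ ν j ∧ ν j ≤ 1) {V t : ℝ} (hV : V = ∑ j, ν j * (1 - ν j)) (hV0 : 0 < V)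
    (ht : |t| ≤ √V) :
    ‖∏ j, centeredBernoulliCharFun (ν j) (t / √V) - Complex.exp (-(t ^ 2 / 2))‖ ≤
      2 * |t| ^ 3 / √V := by
  have hs : 0 < √V := Real.sqrt_pos.2 hV0
  have hu : |t / √V| ≤ 1 := by
    rw [abs_div, abs_of_pos hs]
    exact (div_le_one hs).2 ht
  have hexp : Complex.exp (-(t ^ 2 / 2)) =
      ∏ j, ((Real.exp (-(ν j * (1 - ν j) * (t / √V) ^ 2 / 2)) : ℝ) : ℂ) := by
    rw [← Complex.ofReal_prod, ← Real.exp_sum]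
    have : ∑ j, -(ν j * (1 - ν j) * (t / √V) ^ 2 / 2) = -(t ^ 2 / 2) := by
      rw [Finset.sum_neg_distrib, ← Finset.sum_div, ← Finset.sum_mul, ← hV, div_pow,
        Real.sq_sqrt hV0.le, mul_div_cancel₀ _ hV0.ne']
    rw [this]
    push_cast
    rfl
  rw [hexp]
  refine (norm_prod_sub_prod_le _
    (fun j => norm_centeredBernoulliCharFun_le (hν j).1 (hν j).2) fun j => ?_).trans ?_
  · rw [Complex.norm_real, Real.norm_of_nonneg (Real.exp_pos _).le, Real.exp_le_one_iff]
    have := mul_nonneg (mul_nonneg (hν j).1 (sub_nonneg.2 (hν j).2)) (sq_nonneg (t / √V))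
    linarith
  · calc _ ≤ ∑ j, 2 * (ν j * (1 - ν j)) * |t / √V| ^ 3 := Finset.sum_le_sum fun j _ =>
          norm_centeredBernoulliCharFun_sub_exp_le (hν j).1 (hν j).2 hu
      _ = 2 * V * |t / √V| ^ 3 := by rw [← Finset.sum_mul, ← Finset.mul_sum, ← hV]
      _ = _ := by
          rw [abs_div, abs_of_pos hs, div_pow]
          have : V = √V ^ 2 := (Real.sq_sqrt hV0.le).symm
          rw [this, Real.sqrt_sq hs.le]
          field_simp

/-- Since `m = ∑ ν j`, the phase due to centering splits into one phase for each Bernoulli factor.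
-/
theorem charFun_map_centered {Ω : Type*} [MeasurableSpace Ω] {P : Measure Ω}
    {N : Ω → ℝ} (hN : AEMeasurable N P) {d : ℕ} {ν : Fin d → ℝ} {m s : ℝ} (hm : m = ∑ j, ν j)
    (hexp : ∀ t : ℝ, ∫ ω, Complex.exp (t * N ω * Complex.I) ∂P =
      ∏ j, (1 + ν j * (Complex.exp (t * Complex.I) - 1))) (t : ℝ) :
    charFun (P.map fun ω => (N ω - m) / s) t = ∏ j, centeredBernoulliCharFun (ν j) (t / s) := by
  rw [charFun_apply_real, integral_map (by fun_prop) (by fun_prop)]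
  simp only [centeredBernoulliCharFun]
  rw [Finset.prod_mul_distrib, ← hexp, ← Complex.exp_sum, ← integral_mul_const]
  refine integral_congr_ae (Eventually.of_forall fun ω => ?_)
  simp only
  rw [← Complex.exp_add, ← Finset.sum_mul]
  congr 1
  rw [hm, Finset.sum_neg_distrib, ← Finset.sum_mul]
  push_cast
  ring

end CentralLimit

end PfaffianField

end

/-! ### Convergence to the Gaussian law -/

theorem theorem6 {Λ : ℕ → Type*} [∀ n, MeasurableSpace (Λ n)]
    (μ : ∀ n, Measure (Λ n)) [∀ n, SigmaFinite (μ n)]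
    (P : ∀ n, Measure (PfaffianField.Configuration (Λ n))) [∀ n, IsProbabilityMeasure (P n)]
    (K : ∀ n, Λ n → Λ n → ℍ[ℂ])
    (hPf : ∀ n, PfaffianField.IsPfaffianField (P n) (μ n) (K n))
    (hrank : ∀ n, PfaffianField.IsFiniteRank (K n) (μ n))
    (heig : ∀ n (z : ℂ), PfaffianField.IsEigenvalue (K n) (μ n) z →
      ∃ t : ℝ, 0 ≤ t ∧ t ≤ 1 ∧ z = (t : ℂ))
    (hvar : Tendsto (fun n => variance PfaffianField.numPoints (P n)) atTop atTop) :
    (∀ n, (∀ᵐ c ∂(P n), c.count Set.univ ≠ ∞) ∧ MemLp PfaffianField.numPoints 2 (P n)) ∧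
    TendstoInDistribution
      (fun n (c : PfaffianField.Configuration (Λ n)) =>
        (PfaffianField.numPoints c - ∫ c', PfaffianField.numPoints c' ∂(P n)) /
          Real.sqrt (variance PfaffianField.numPoints (P n)))
      atTop (id : ℝ → ℝ) P (gaussianReal 0 1) := by
  have key := fun n => (hPf n).exists_bernoulli_parameters (hrank n) (heig n)
  have hmeas : ∀ n, AEMeasurable PfaffianField.numPoints (P n) := fun n =>
    (key n).2.1.aestronglyMeasurable.aemeasurable
  refine ⟨fun n => ⟨(key n).1, (key n).2.1⟩, ⟨fun n => by
    have := hmeas n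
    fun_prop, by fun_prop, ?_⟩⟩
  refine ProbabilityMeasure.tendsto_iff_tendsto_charFun.2 fun t => ?_
  choose d ν hν hmean hvar' hexp using fun n => (key n).2.2
  have hlim : charFun ((gaussianReal 0 1).map (id : ℝ → ℝ)) t = Complex.exp (-(t ^ 2 / 2)) := by
    rw [Measure.map_id, charFun_gaussianReal]
    simp
  have hsqrt : Tendsto (fun n => √(variance PfaffianField.numPoints (P n))) atTop atTop :=
    Real.tendsto_sqrt_atTop.comp hvar
  simp only [ProbabilityMeasure.coe_mk]
  rw [hlim, tendsto_iff_norm_sub_tendsto_zero]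
  refine squeeze_zero' (Eventually.of_forall fun n => norm_nonneg _) ?_
    (hsqrt.const_div_atTop (2 * |t| ^ 3))
  -- The cubic estimate needs `|t| ≤ √Var` and a positive variance; both hold for all large `n`.
  filter_upwards [hsqrt.eventually_ge_atTop |t|, hvar.eventually_gt_atTop 0] with n hn hn0
  rw [PfaffianField.charFun_map_centered (hmeas n) (hmean n) (hexp n)]
  exact PfaffianField.norm_prod_centeredBernoulliCharFun_sub_le (hν n) (hvar' n) hn0 hn
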